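/- Write $\mathbb{T}=\mathbb{R}/2\pi\mathbb{Z}$, $\mathbb{Z}_0=\mathbb{Z}\setminus\{0\}$, $f_k=\frac1{2\pi}\int_{\mathbb{T}} f(x)e^{-ikx}\,dx$. Let $(s,p)\in\mathbb{R}^2$ satisfy either (i) $s>\frac12-\frac1p$, $p>2$, or (ii) $s\ge 0$, $p=2$. For real $r$ let $\mathcal{F}L^{r,p}_0(\mathbb{T})$ be the space of mean-zero functions $f$ on $\mathbb{T}$ with $\|f\|_{\mathcal{F}L^{r,p}_0}=\big\||k|^{r}f_k\big\|_{\ell^p(\mathbb{Z}_0)}<\infty$ (for $r\ge s$ it is contained in $L^2(\mathbb{T})$). For mean-zero $v$, $t\in\mathbb{R}$, $k\in\mathbb{Z}_0$ and $n\ge1$, let $$\mathcal{N}^n_k(t)(v)=\frac{(-1)^n k}{2^{n-1}n!}\sum_{\substack{k_1,\dots,k_n\in\mathbb{Z}_0\\ k_1+\dots+k_n=k}}e^{i\Phi_n t}\prod_{j=1}^n\frac{v_{k_j}}{k_j},\qquad \Phi_n=\Big(\sum_{j=1}^n k_j\Big)^2-\sum_{j=1}^n k_j^2,$$ so that $\mathcal{N}^1(t)(v)=-v$,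 and for $n\ge2$ let $$\mathcal{R}^n_k(t)(v)=-\frac i4\,\Big(\sum_{m\in\mathbb{Z}_0}e^{-2im^2t}v_mv_{-m}\Big)\,\mathcal{N}^{n-1}_k(t)(v).$$ The normal form equation with initial datum $\phi$ is $$v(t)=\phi+\sum_{n=2}^\infty\mathcal{N}^n(t)(v(t))-\sum_{n=2}^\infty\mathcal{N}^n(0)(\phi)+\int_0^t\sum_{n=2}^\infty\mathcal{R}^n(t')(v(t'))\,dt'.\tag{NF}$$ A solution of (NF) in $C([0,T];\mathcal{F}L^{s,p}_0(\mathbb{T}))$ is a $v$ in this space with $v|_{t=0}=\phi$ for which the multiple sums over frequencies above converge absolutely, the two series in $n$ converge absolutely in $\mathcal{F}L^{s,p}_0$ at every $t\in[0,T]$, the time integrand is integrable in $\mathcal{F}L^{s,p}_0$ on $[0,T]$, and (NF) holds for all $t\in[0,T]$. **Proposition.** There exist $\delta_1=\delta_1(s,p)>0$ and a function $T:\mathbb{R}\to(0,\infty)$, depending only on $(s,p)$, such that: 1. (Local well-posedness.) For every $\phi\in\mathcal{F}L^{s,p}_0(\mathbb{T})$ with $\|\phi\|_{\mathcal{F}L^{s,p}_0}\le\delta_1$,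 setting $T=T(\|\phi\|_{\mathcal{F}L^{s,p}_0})$, there is a unique solution $v$ of (NF) in $C([0,T];\mathcal{F}L^{s,p}_0(\mathbb{T}))$ with $v|_{t=0}=\phi$. 2. (Persistence of regularity.) For every $\sigma>0$ there are $\delta\in(0,\delta_1]$ and a function $T':\mathbb{R}\to(0,\infty)$ with $T'\le T$, both depending only on $(s,p,\sigma)$, such that if $\phi\in\mathcal{F}L^{s+\sigma,p}_0(\mathbb{T})$ and $\|\phi\|_{\mathcal{F}L^{s,p}_0}\le\delta$, then the solution $v$ of part 1 satisfies $v(t)\in\mathcal{F}L^{s+\sigma,p}_0(\mathbb{T})$ and $\|v(t)\|_{\mathcal{F}L^{s+\sigma,p}_0}\le\frac52\|\phi\|_{\mathcal{F}L^{s+\sigma,p}_0}$ for all $0\le t\le T'(\|\phi\|_{\mathcal{F}L^{s,p}_0})$. -/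

import Mathlib

noncomputable section

namespace NormalForm

open MeasureTheory Set Filter Topology
open scoped ENNReal

instance fact_two_pi_pos : Fact (0 < 2 * Real.pi) := ⟨Real.two_pi_pos⟩

/-- The space `L²(𝕋)` of complex-valued functions on `𝕋 = ℝ / 2πℤ`
(with respect to `dx / 2π`). -/
abbrev L2Torus : Type :=
  Lp ℂ 2 (AddCircle.haarAddCircle : Measure (AddCircle (2 * Real.pi)))

/-- The Fourier coefficients `f_k = (1 / 2π) ∫ f(x) e^{-ikx} dx`. -/
def coeff (f : L2Torus) (k : ℤ) : ℂ := fourierCoeff (f : AddCircle (2 * Real.pi) → ℂ) k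

/-- The nonzero frequencies `ℤ₀ = ℤ \ {0}`. -/
abbrev ZNonzero : Type := {k : ℤ // k ≠ 0}

/-- The Fourier-Lebesgue norm `‖ |k|^s a_k ‖_{ℓ^p(ℤ₀)}` of a family of Fourier coefficients,
with values in `[0, ∞]`; only the coefficients at nonzero frequencies enter. -/
def flNorm (s p : ℝ) (a : ℤ → ℂ) : ℝ≥0∞ :=
  (∑' k : ZNonzero, (ENNReal.ofReal (|((k : ℤ) : ℝ)| ^ s) * ‖a k‖ₑ) ^ p) ^ (1 / p)

/-- The Fourier-Lebesgue space `FL₀^{s,p}(𝕋)` of mean-zero functions with finite norm.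
It is used only for exponents for which it embeds into `L²(𝕋)`, so that its elements may be taken
in `L²(𝕋)` from the start. -/
def FL (s p : ℝ) : Set L2Torus :=
  {f | coeff f 0 = 0 ∧ flNorm s p (coeff f) < ∞}

/-- `v` belongs to `C([0, T]; FL₀^{s,p}(𝕋))`. -/
def IsContinuousFL (s p T : ℝ) (v : ℝ → L2Torus) : Prop :=
  (∀ t ∈ Icc 0 T, v t ∈ FL s p) ∧
    ∀ t₀ ∈ Icc 0 T,
      Tendsto (fun t => flNorm s p (coeff (v t - v t₀))) (𝓝[Icc 0 T] t₀) (𝓝 0)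

/-- The `n`-tuples `(k₁, …, k_n)` of nonzero frequencies with `k₁ + ⋯ + k_n = m`. -/
abbrev Freq (n : ℕ) (m : ℤ) : Type :=
  {k : Fin n → ℤ // (∀ j, k j ≠ 0) ∧ ∑ j, k j = m}

/-- The modulation function `Φ_n(k) = (∑ k_j)² - ∑ k_j²`. -/
def modulation {n : ℕ} (k : Fin n → ℤ) : ℤ := (∑ j, k j) ^ 2 - ∑ j, k j ^ 2

/-- The summand `e^{i Φ_n(k) t} ∏_j v_{k_j} / k_j`. -/
def summandN {n : ℕ} (t : ℝ) (a : ℤ → ℂ) (k : Fin n → ℤ) : ℂ :=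
  Complex.exp (Complex.I * (modulation k : ℂ) * (t : ℂ)) * ∏ j, a (k j) / (k j : ℂ)

/-- The `m`-th Fourier coefficient of `𝒩ⁿ(t)(v)`, where `a` are the coefficients of `v`:
`(-1)ⁿ m / (2^{n-1} n!) ∑_{k₁ + ⋯ + k_n = m} e^{i Φ_n(k) t} ∏_j a_{k_j} / k_j`, for `n ≥ 1`.
For `n = 1` this is `-a_m`. -/
def termN (n : ℕ) (t : ℝ) (a : ℤ → ℂ) (m : ℤ) : ℂ :=
  (-1) ^ n * (m : ℂ) / (2 ^ (n - 1) * (n.factorial : ℂ)) * ∑' k : Freq n m, summandN t a k.1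

/-- The summand `e^{-2 i m² t} v_m v_{-m}`. -/
def summandM (t : ℝ) (a : ℤ → ℂ) (m : ℤ) : ℂ :=
  Complex.exp (-2 * Complex.I * (m : ℂ) ^ 2 * (t : ℂ)) * a m * a (-m)

/-- `M(u) = (1 / 2π) ∫ u² dx` for `u = e^{it∂ₓ²} v`, that is
`∑_{m ≠ 0} e^{-2 i m² t} v_m v_{-m}`. -/
def massM (t : ℝ) (a : ℤ → ℂ) : ℂ := ∑' m : ZNonzero, summandM t a m

/-- The `m`-th Fourier coefficient of `ℛⁿ(t)(v) = -(i/4) M(u) 𝒩^{n-1}(t)(v)`, for `n ≥ 2`. -/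
def termR (n : ℕ) (t : ℝ) (a : ℤ → ℂ) (m : ℤ) : ℂ :=
  -(Complex.I / 4) * massM t a * termN (n - 1) t a m

/-- All the series in the normal form equation converge at time `t`, for a function with Fourier
coefficients `a`: the multiple sums defining the coefficients converge absolutely, and the series
`∑_{n ≥ 2} 𝒩ⁿ(t)(v)` and `∑_{n ≥ 2} ℛⁿ(t)(v)` converge absolutely in `FL₀^{s,p}`. -/
structure SeriesConverge (s p t : ℝ) (a : ℤ → ℂ) : Prop where
  summable_summandN : ∀ n : ℕ, 1 ≤ n → ∀ m : ℤ, m ≠ 0 →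
    Summable (fun k : Freq n m => summandN t a k.1)
  summable_summandM : Summable (fun m : ZNonzero => summandM t a m)
  series_termN : ∑' n : ℕ, flNorm s p (termN (n + 2) t a) < ∞
  series_termR : ∑' n : ℕ, flNorm s p (termR (n + 2) t a) < ∞

/-- `v ∈ C([0, T]; FL₀^{s,p})` solves the normal form equation
`v(t) = φ + ∑_{n ≥ 2} 𝒩ⁿ(t)(v(t)) - ∑_{n ≥ 2} 𝒩ⁿ(0)(φ) + ∫₀ᵗ ∑_{n ≥ 2} ℛⁿ(t')(v(t')) dt'`
on `[0, T]` with `v(0) = φ`. The series converge absolutely in `FL₀^{s,p}`, the last integrand is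
integrable with values in `FL₀^{s,p}`, and the equation is an identity of the Fourier coefficients
at all nonzero frequencies. -/
structure IsSolution (s p T : ℝ) (φ : L2Torus) (v : ℝ → L2Torus) : Prop where
  continuous : IsContinuousFL s p T v
  initial : v 0 = φ
  converge : ∀ t ∈ Icc 0 T, SeriesConverge s p t (coeff (v t))
  integrable : ∫⁻ t in Icc 0 T, ∑' n : ℕ, flNorm s p (termR (n + 2) t (coeff (v t))) < ∞
  integrable_coeff : ∀ m : ℤ, m ≠ 0 →
    IntervalIntegrable (fun t => ∑' n : ℕ, termR (n + 2) t (coeff (v t)) m) volume 0 T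
  equation : ∀ t ∈ Icc 0 T, ∀ m : ℤ, m ≠ 0 →
    coeff (v t) m = coeff φ m
      + ∑' n : ℕ, termN (n + 2) t (coeff (v t)) m
      - ∑' n : ℕ, termN (n + 2) 0 (coeff φ) m
      + ∫ t' in (0 : ℝ)..t, ∑' n : ℕ, termR (n + 2) t' (coeff (v t')) m

end NormalForm

end

noncomputable section

namespace NormalForm

open MeasureTheory Set Filter Topology
open scoped ENNReal

/-! With x_k = |k|^s f_k the space FL₀^{s,p} becomes ℓ^p(ℤ₀), on which S(t), multiplication by
e^{-ik²t}, is an isometry. The modulation Φ_n is a difference of output and input phases, so 𝒩ⁿ(t) =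
S(-t) 𝒩ⁿ(0) S(t), and likewise for ℛⁿ (`summandN_eq`, `termR_eq`). Estimates are therefore needed at
time 0 only, with absolute values inside the sums.

In 𝒩ⁿ(0) the outer |k|^{1+s} is at most n^{1+s} times the same power of the largest input frequency,
and this cancels the 1/k_j there. That input is measured in ℓ^p, the others through ∑ |v_k|/|k|,
which Hölder controls; Young's inequality then gives the bound n^{2+s} C^{n-1} (`flNorm_conv_le`).
Hence G = ∑_{n≥2} 𝒩ⁿ(0) is a power series of positive radius starting in degree 2. Since 𝒩¹ = -id,
the sum of the ℛⁿ(0) is H = -(i/4) M (G - id), where M is bounded through the embedding into ℓ²;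
this embedding is what forces s > 1/2 - 1/p. Both G and H have derivative 0 at the origin, so both
are 1/8-Lipschitz on a small ball.

Smallness of the data, not of the time, yields the contraction (`exists_solvesAt`), so T = 1 works.
Uniqueness holds among all solutions because a continuity argument (`norm_le_of_solvesAt`) confines
each of them to the ball.

For persistence, an additional weight min(|k|, N)^σ also falls on a single input. The estimates are
linear in the weighted norm, uniform in N, and need smallness in FL₀^{s,p} only. Truncation makes
the weight a bounded operator, so the weighted norm is finite beforehand and can be absorbed
(`norm_clm_le_of_solvesAt`); then N is sent to infinity. -/

/-! ### `ℓ^p` norms of `[0, ∞]`-valued families -/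

section EllNorm

variable {ι κ : Type*} {p : ℝ}

/-- The `ℓ^p` norm of a family with values in `[0, ∞]`. -/
def ellNorm (p : ℝ) (f : ι → ℝ≥0∞) : ℝ≥0∞ := (∑' i, f i ^ p) ^ (1 / p)

theorem ellNorm_mono (hp : 0 ≤ p) {f g : ι → ℝ≥0∞} (h : ∀ i, f i ≤ g i) :
    ellNorm p f ≤ ellNorm p g :=
  ENNReal.rpow_le_rpow (ENNReal.tsum_le_tsum fun i => ENNReal.rpow_le_rpow (h i) hp)
    (by positivity)

theorem ellNorm_zero (hp : 0 < p) : ellNorm p (fun _ : ι => 0) = 0 := by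
  simp [ellNorm, hp]

theorem ellNorm_const_mul (hp : 0 < p) (c : ℝ≥0∞) (f : ι → ℝ≥0∞) :
    ellNorm p (fun i => c * f i) = c * ellNorm p f := by
  simp only [ellNorm, ENNReal.mul_rpow_of_nonneg _ _ hp.le, ENNReal.tsum_mul_left]
  rw [ENNReal.mul_rpow_of_nonneg _ _ (by positivity), ← ENNReal.rpow_mul,
    mul_one_div_cancel hp.ne', ENNReal.rpow_one]

theorem ellNorm_rpow (hp : 0 < p) (f : ι → ℝ≥0∞) : ellNorm p f ^ p = ∑' i, f i ^ p := by
  rw [ellNorm, ← ENNReal.rpow_mul, one_div_mul_cancel hp.ne', ENNReal.rpow_one]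

theorem le_ellNorm (hp : 0 < p) (f : ι → ℝ≥0∞) (i : ι) : f i ≤ ellNorm p f := by
  rw [← ENNReal.rpow_le_rpow_iff hp, ellNorm_rpow hp]
  exact ENNReal.le_tsum (f := fun i => f i ^ p) i

theorem ellNorm_le_iff (hp : 0 < p) {f : ι → ℝ≥0∞} {C : ℝ≥0∞} :
    ellNorm p f ≤ C ↔ ∀ u : Finset ι, ∑ i ∈ u, f i ^ p ≤ C ^ p := by
  rw [← ENNReal.rpow_le_rpow_iff hp, ellNorm_rpow hp, ENNReal.tsum_eq_iSup_sum, iSup_le_iff]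

theorem sum_rpow_le_ellNorm_rpow (hp : 0 < p) (f : ι → ℝ≥0∞) (u : Finset ι) :
    ∑ i ∈ u, f i ^ p ≤ ellNorm p f ^ p := by
  rw [ellNorm_rpow hp]
  exact ENNReal.sum_le_tsum u

theorem ellNorm_add_le (hp : 1 ≤ p) (f g : ι → ℝ≥0∞) :
    ellNorm p (fun i => f i + g i) ≤ ellNorm p f + ellNorm p g := by
  have hp0 : 0 < p := by linarith
  rw [ellNorm_le_iff hp0]
  intro u
  have h := ENNReal.Lp_add_le u f g hp
  have h2 : (∑ i ∈ u, f i ^ p) ^ (1 / p) + (∑ i ∈ u, g i ^ p) ^ (1 / p)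
      ≤ ellNorm p f + ellNorm p g := by
    gcongr <;> exact ENNReal.rpow_le_rpow (ENNReal.sum_le_tsum u) (by positivity)
  have h3 := ENNReal.rpow_le_rpow (h.trans h2) hp0.le
  rwa [← ENNReal.rpow_mul, one_div_mul_cancel hp0.ne', ENNReal.rpow_one] at h3

theorem ellNorm_sum_le (hp : 1 ≤ p) (u : Finset κ) (f : κ → ι → ℝ≥0∞) :
    ellNorm p (fun i => ∑ j ∈ u, f j i) ≤ ∑ j ∈ u, ellNorm p (f j) := by
  classical
  induction u using Finset.induction_on with
  | empty => simp [ellNorm_zero (show 0 < p by linarith)]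
  | insert j u hj ih =>
    simp only [Finset.sum_insert hj]
    exact (ellNorm_add_le hp _ _).trans (by gcongr)

/-- Hölder's inequality for sums with values in `[0, ∞]`. -/
theorem tsum_mul_le_ellNorm {q : ℝ} (hpq : p.HolderConjugate q) (f g : ι → ℝ≥0∞) :
    ∑' i, f i * g i ≤ ellNorm p f * ellNorm q g := by
  rw [ENNReal.tsum_eq_iSup_sum]
  refine iSup_le fun u => (ENNReal.inner_le_Lp_mul_Lq u f g hpq).trans ?_
  have h1 := hpq.pos
  have h2 := hpq.symm.pos
  gcongr <;> exact ENNReal.rpow_le_rpow (ENNReal.sum_le_tsum u) (by positivity)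

/-- Jensen's inequality for a weighted sum with values in `[0, ∞]`. -/
theorem tsum_mul_rpow_le (hp : 1 ≤ p) (w f : ι → ℝ≥0∞) :
    (∑' i, w i * f i) ^ p ≤ (∑' i, w i) ^ (p - 1) * ∑' i, w i * f i ^ p := by
  have hp0 : 0 < p := by linarith
  have hp1 : 0 ≤ 1 - p⁻¹ := by
    rw [sub_nonneg]; exact inv_le_one_of_one_le₀ hp
  have h : ∑' i, w i * f i ≤ (∑' i, w i) ^ (1 - p⁻¹) * (∑' i, w i * f i ^ p) ^ p⁻¹ := by
    rw [ENNReal.tsum_eq_iSup_sum]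
    refine iSup_le fun u => (ENNReal.inner_le_weight_mul_Lp_of_nonneg u hp w f).trans ?_
    gcongr
    · exact ENNReal.sum_le_tsum u
    · exact ENNReal.sum_le_tsum (f := fun i => w i * f i ^ p) u
  refine (ENNReal.rpow_le_rpow h hp0.le).trans_eq ?_
  rw [ENNReal.mul_rpow_of_nonneg _ _ hp0.le, ← ENNReal.rpow_mul, ← ENNReal.rpow_mul,
    inv_mul_cancel₀ hp0.ne', ENNReal.rpow_one, sub_mul, one_mul, inv_mul_cancel₀ hp0.ne']

/-- A weighted form of Schur's test. -/
theorem ellNorm_schur_le (hp : 1 ≤ p) (K : ι → κ → ℝ≥0∞) (F G : κ → ℝ≥0∞) (C : ℝ≥0∞)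
    (h1 : ∀ k, ∑' i, K i k ≤ 1) (h2 : ∀ i, ∑' k, K i k * G k ≤ C) :
    ellNorm p (fun i => ∑' k, K i k * (F k * G k))
      ≤ C ^ (1 - 1 / p) * (∑' k, F k ^ p * G k) ^ (1 / p) := by
  have hp0 : 0 < p := by linarith
  have h3 : ∑' i, (∑' k, K i k * (F k * G k)) ^ p ≤ C ^ (p - 1) * ∑' k, F k ^ p * G k := by
    calc ∑' i, (∑' k, K i k * (F k * G k)) ^ p
        ≤ ∑' i, C ^ (p - 1) * ∑' k, K i k * (F k ^ p * G k) := by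
          refine ENNReal.tsum_le_tsum fun i => ?_
          -- Jensen with weights K i k * G k: their total mass is at most C by `h2`.
          have := tsum_mul_rpow_le hp (fun k => K i k * G k) F
          refine le_trans (le_of_eq ?_) (this.trans ?_)
          · congr 2; ext k; ring
          · refine mul_le_mul' (ENNReal.rpow_le_rpow (h2 i) (by linarith)) (le_of_eq ?_)
            congr 1; ext k; ring
      _ = C ^ (p - 1) * ∑' k, (∑' i, K i k) * (F k ^ p * G k) := by
          rw [ENNReal.tsum_mul_left, ENNReal.tsum_comm]
          simp only [ENNReal.tsum_mul_right]
      _ ≤ C ^ (p - 1) * ∑' k, F k ^ p * G k := by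
          exact mul_le_mul' le_rfl
            (ENNReal.tsum_le_tsum fun k => mul_le_of_le_one_left' (h1 k))
  refine (ENNReal.rpow_le_rpow h3 (by positivity)).trans_eq ?_
  rw [ENNReal.mul_rpow_of_nonneg _ _ (by positivity), ← ENNReal.rpow_mul]
  congr 2
  field_simp

theorem tsum_pi_prod {ι : Type*} : ∀ (n : ℕ) (g : Fin n → ι → ℝ≥0∞),
    ∑' k : Fin n → ι, ∏ j, g j (k j) = ∏ j, ∑' i, g j i
  | 0, g => by simp
  | n + 1, g => by
    rw [← (Fin.insertNthEquiv (fun _ => ι) 0).tsum_eq, Fin.prod_univ_succ,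
      ENNReal.tsum_prod', ← tsum_pi_prod n]
    simp only [Fin.prod_univ_succ, Fin.insertNthEquiv_zero, Fin.consEquiv_apply, Fin.cons_zero,
      Fin.cons_succ, ENNReal.tsum_mul_left, ENNReal.tsum_mul_right]

end EllNorm

/-! ### Sums over frequencies with prescribed total -/

/-- The tuples in `Freq n m`, as tuples of elements of `ZNonzero`. -/
def freqEquiv (n : ℕ) (m : ℤ) :
    Freq n m ≃ {k : Fin n → ZNonzero | ∑ j, (k j : ℤ) = m} where
  toFun k := ⟨fun j => ⟨k.1 j, k.2.1 j⟩, k.2.2⟩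
  invFun k := ⟨fun j => (k.1 j : ℤ), fun j => (k.1 j).2, k.2⟩
  left_inv _ := rfl
  right_inv _ := rfl

theorem tsum_freq {n : ℕ} {m : ℤ} (φ : (Fin n → ℤ) → ℝ≥0∞) :
    ∑' k : Freq n m, φ k.1
      = ∑' k : Fin n → ZNonzero, (if ∑ j, (k j : ℤ) = m then 1 else 0) * φ (fun j => k j) := by
  rw [← (freqEquiv n m).symm.tsum_eq]
  have := tsum_subtype {k : Fin n → ZNonzero | ∑ j, (k j : ℤ) = m} (fun k => φ (fun j => k j))
  refine this.trans (tsum_congr fun k => ?_)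
  simp [Set.indicator_apply]

/-- The constraint k₁ + ⋯ + k_n = m determines m from the k_j, and any one k_j from m and the rest;
this bounds both marginals of the kernel in Schur's test. -/
theorem tsum_ite_eq_le_one {ι κ : Type*} [DecidableEq κ] (e : ι → κ) (he : e.Injective) (c : κ) :
    ∑' i, (if e i = c then (1 : ℝ≥0∞) else 0) ≤ 1 := by
  by_cases h : ∃ i, e i = c
  · obtain ⟨i, rfl⟩ := h
    classical
    rw [tsum_eq_single i fun j hj => if_neg fun h => hj (he h)]
    simp
  · push Not at h
    simp [h]

/-- Young's inequality for the `ℓ^p` norm of an `n`-fold convolution. -/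
theorem ellNorm_freq_le {p : ℝ} (hp : 1 ≤ p) {n : ℕ} (i : Fin (n + 1)) (f : ℤ → ℝ≥0∞)
    (g : Fin n → ℤ → ℝ≥0∞) :
    ellNorm p (fun m : ZNonzero => ∑' k : Freq (n + 1) m,
        f (k.1 i) * ∏ j, g j (k.1 (i.succAbove j)))
      ≤ ellNorm p (fun l : ZNonzero => f l) * ∏ j, ∑' l : ZNonzero, g j l := by
  have hp0 : 0 < p := by linarith
  -- Splits off the coordinate `i`, the one measured in ℓ^p, from those summed in ℓ¹.
  set e := Fin.insertNthEquiv (fun _ : Fin (n + 1) => ZNonzero) i with he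
  have e1 : ∀ x, e x i = x.1 := fun x => by simp [he]
  have e2 : ∀ x j, e x (i.succAbove j) = x.2 j := fun x j => by simp [he]
  set P := ∏ j, ∑' l : ZNonzero, g j l with hP
  simp only [tsum_freq (fun k : Fin (n + 1) → ℤ => f (k i) * ∏ j, g j (k (i.succAbove j)))]
  refine (ellNorm_schur_le hp
    (fun (m : ZNonzero) (k : Fin (n + 1) → ZNonzero) =>
      (if ∑ j, (k j : ℤ) = (m : ℤ) then (1 : ℝ≥0∞) else 0))
    (fun k => f (k i)) (fun k => ∏ j, g j (k (i.succAbove j))) P ?_ ?_).trans ?_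
  · intro k
    simp only [eq_comm (a := ∑ j, (k j : ℤ))]
    exact tsum_ite_eq_le_one _ Subtype.val_injective _
  · intro m
    rw [← e.tsum_eq, ENNReal.tsum_prod', ENNReal.tsum_comm, hP,
      ← tsum_pi_prod n (fun j (l : ZNonzero) => g j l)]
    refine ENNReal.tsum_le_tsum fun r => ?_
    simp only [e2, ENNReal.tsum_mul_right]
    refine mul_le_of_le_one_left' ?_
    simp only [Fin.sum_univ_succAbove _ i, e1, e2]
    refine tsum_ite_eq_le_one (fun l : ZNonzero => (l : ℤ) + ∑ j, (r j : ℤ)) ?_ _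
    intro a b h
    exact Subtype.ext (add_right_cancel h)
  · rw [← e.tsum_eq, ENNReal.tsum_prod']
    simp only [e1, e2, ENNReal.tsum_mul_left, ENNReal.tsum_mul_right]
    rw [tsum_pi_prod n (fun j (l : ZNonzero) => g j l), ← hP,
      ENNReal.mul_rpow_of_nonneg _ _ (by positivity), ← mul_assoc, mul_comm (P ^ _), mul_assoc,
      ← ENNReal.rpow_add_of_nonneg _ _ (by
        rw [sub_nonneg]; exact (div_le_one hp0).2 hp) (by positivity)]
    simp [ellNorm]

/-- A weight `ω` for which the `n`-linear convolution can be estimated by putting `ω` on a single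
factor. -/
def IsConvWeight (n : ℕ) (ω : ℤ → ℝ≥0∞) (B : ℝ≥0∞) : Prop :=
  ∀ k : Fin n → ℤ, (∀ j, k j ≠ 0) →
    ω (∑ j, k j) * ‖((∑ j, k j : ℤ) : ℂ)‖ₑ ≤ B * ∑ j, ω (k j) * ‖(k j : ℂ)‖ₑ

theorem enorm_intCast_ne_zero {k : ℤ} (hk : k ≠ 0) : ‖(k : ℂ)‖ₑ ≠ 0 := by simpa using hk

/-- The multilinear estimate for the sums over `Freq n m`. -/
theorem ellNorm_conv_le {p : ℝ} (hp : 1 ≤ p) {n : ℕ} {ω : ℤ → ℝ≥0∞} {B : ℝ≥0∞}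
    (hω : IsConvWeight (n + 1) ω B) (a : Fin (n + 1) → ℤ → ℝ≥0∞) :
    ellNorm p (fun m : ZNonzero => ω m * ‖((m : ℤ) : ℂ)‖ₑ *
        ∑' k : Freq (n + 1) m, ∏ j, a j (k.1 j) / ‖(k.1 j : ℂ)‖ₑ)
      ≤ B * ∑ i, ellNorm p (fun l : ZNonzero => ω l * a i l) *
          ∏ j, ∑' l : ZNonzero, a (i.succAbove j) l / ‖((l : ℤ) : ℂ)‖ₑ := by
  have hp0 : 0 < p := by linarith
  have key : ∀ m : ZNonzero, ω m * ‖((m : ℤ) : ℂ)‖ₑ *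
        ∑' k : Freq (n + 1) m, ∏ j, a j (k.1 j) / ‖(k.1 j : ℂ)‖ₑ
      ≤ B * ∑ i, ∑' k : Freq (n + 1) m, (ω (k.1 i) * a i (k.1 i)) *
          ∏ j, a (i.succAbove j) (k.1 (i.succAbove j)) / ‖(k.1 (i.succAbove j) : ℂ)‖ₑ := by
    intro m
    rw [← (Summable.tsum_finsetSum fun i _ => ENNReal.summable), ← ENNReal.tsum_mul_left,
      ← ENNReal.tsum_mul_left]
    refine ENNReal.tsum_le_tsum fun k => ?_
    have h := hω k.1 k.2.1
    rw [k.2.2] at h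
    refine (mul_le_mul_left h _).trans_eq ?_
    rw [mul_assoc, Finset.sum_mul]
    congr 1
    refine Finset.sum_congr rfl fun i _ => ?_
    rw [Fin.prod_univ_succAbove _ i, ← mul_assoc]
    congr 1
    -- The derivative moved onto the factor `i` cancels the denominator of that factor.
    rw [mul_assoc, ENNReal.mul_div_cancel (enorm_intCast_ne_zero (k.2.1 i)) enorm_ne_top]
  refine (ellNorm_mono hp0.le key).trans ?_
  rw [ellNorm_const_mul hp0]
  gcongr
  refine (ellNorm_sum_le hp _ _).trans ?_
  gcongr with i
  exact ellNorm_freq_le hp i (fun l => ω l * a i l)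
    (fun j l => a (i.succAbove j) l / ‖(l : ℂ)‖ₑ)

/-! ### Weights -/

/-- The weight `|k|^s min(|k|, N)^σ`. -/
def truncWeight (s σ N : ℝ) (k : ℤ) : ℝ := |(k : ℝ)| ^ s * min |(k : ℝ)| N ^ σ

theorem truncWeight_nonneg {s σ N : ℝ} (hN : 0 ≤ N) (k : ℤ) : 0 ≤ truncWeight s σ N k := by
  have : 0 ≤ min |(k : ℝ)| N := le_min (abs_nonneg _) hN
  unfold truncWeight; positivity

/-- Holds for every `N`, including 0, because `0 ^ 0 = 1`. -/
theorem truncWeight_zero_right (s N : ℝ) (k : ℤ) : truncWeight s 0 N k = |(k : ℝ)| ^ s := by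
  simp [truncWeight]

/-- The largest |k_j| = M satisfies |∑ k_j| ≤ nM, and min(nM, N) ≤ n min(M, N) as n ≥ 1, so
truncation costs no dependence on `N`. -/
theorem truncWeight_mul_abs_sum_le {s σ N : ℝ} (hs : 0 ≤ s) (hσ : 0 ≤ σ) (hN : 0 ≤ N) {n : ℕ}
    (hn : 1 ≤ n) (k : Fin n → ℤ) :
    truncWeight s σ N (∑ j, k j) * |((∑ j, k j : ℤ) : ℝ)|
      ≤ (n : ℝ) ^ (1 + s + σ) * ∑ j, truncWeight s σ N (k j) * |(k j : ℝ)| := by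
  have : Nonempty (Fin n) := ⟨⟨0, hn⟩⟩
  obtain ⟨i, -, hi⟩ := Finset.exists_max_image Finset.univ (fun j => |(k j : ℝ)|)
    Finset.univ_nonempty
  set M := |(k i : ℝ)| with hM
  have hM0 : 0 ≤ M := abs_nonneg _
  have hn1 : (1 : ℝ) ≤ n := by exact_mod_cast hn
  have hn0 : (0 : ℝ) ≤ n := by linarith
  have hsum : |((∑ j, k j : ℤ) : ℝ)| ≤ n * M := by
    push_cast
    refine (Finset.abs_sum_le_sum_abs _ _).trans ?_
    refine (Finset.sum_le_card_nsmul _ _ M hi).trans_eq ?_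
    simp
  have hmin : min |((∑ j, k j : ℤ) : ℝ)| N ≤ n * min M N := by
    rw [mul_min_of_nonneg _ _ hn0]
    exact min_le_min hsum (le_mul_of_one_le_left hN hn1)
  have hminM : 0 ≤ min M N := le_min hM0 hN
  have hmin0 : 0 ≤ min |((∑ j, k j : ℤ) : ℝ)| N := le_min (abs_nonneg _) hN
  calc truncWeight s σ N (∑ j, k j) * |((∑ j, k j : ℤ) : ℝ)|
      ≤ ((n * M) ^ s * (n * min M N) ^ σ) * (n * M) := by
        unfold truncWeight
        gcongr
    _ = (n : ℝ) ^ (1 + s + σ) * ((M ^ s * min M N ^ σ) * M) := by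
        rw [Real.mul_rpow hn0 hM0, Real.mul_rpow hn0 hminM,
          Real.rpow_add (by linarith), Real.rpow_add (by linarith), Real.rpow_one]
        ring
    _ ≤ _ := by
        gcongr
        exact Finset.single_le_sum (f := fun j => truncWeight s σ N (k j) * |(k j : ℝ)|)
          (fun j _ => mul_nonneg (truncWeight_nonneg hN _) (abs_nonneg _)) (Finset.mem_univ i)

theorem isConvWeight_truncWeight {s σ N : ℝ} (hs : 0 ≤ s) (hσ : 0 ≤ σ) (hN : 0 ≤ N) {n : ℕ}
    (hn : 1 ≤ n) :
    IsConvWeight n (fun k => ENNReal.ofReal (truncWeight s σ N k))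
      (ENNReal.ofReal ((n : ℝ) ^ (1 + s + σ))) := by
  intro k _
  have hc : ∀ l : ℤ, ‖(l : ℂ)‖ₑ = ENNReal.ofReal |(l : ℝ)| := fun l => by
    rw [← ofReal_norm]; simp
  have h0 := fun l => truncWeight_nonneg (s := s) (σ := σ) hN l
  simp only [hc, ← ENNReal.ofReal_mul (h0 _)]
  rw [← ENNReal.ofReal_sum_of_nonneg fun j _ => mul_nonneg (h0 _) (abs_nonneg _),
    ← ENNReal.ofReal_mul (by positivity)]
  exact ENNReal.ofReal_le_ofReal (truncWeight_mul_abs_sum_le hs hσ hN hn k)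

theorem flNorm_eq_ellNorm (s p : ℝ) (a : ℤ → ℂ) :
    flNorm s p a = ellNorm p (fun k : ZNonzero => ENNReal.ofReal (|((k : ℤ) : ℝ)| ^ s) * ‖a k‖ₑ) :=
  rfl

theorem one_le_abs_znonzero (k : ZNonzero) : 1 ≤ |((k : ℤ) : ℝ)| := by
  exact_mod_cast Int.one_le_abs k.2

/-- The power weights `|k|^{-r}` lie in `ℓ^q` as soon as `r q > 1`. -/
theorem ellNorm_rpow_neg_lt_top {r q : ℝ} (hq : 0 < q) (h : 1 < r * q) :
    ellNorm q (fun k : ZNonzero => ENNReal.ofReal (|((k : ℤ) : ℝ)| ^ (-r))) < ∞ := by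
  refine ENNReal.rpow_lt_top_of_nonneg (by positivity) ?_
  have h1 : Summable fun k : ℤ => |(k : ℝ)| ^ (-(r * q)) := Real.summable_abs_int_rpow h
  have h2 := (h1.comp_injective (i := fun k : ZNonzero => (k : ℤ)) Subtype.val_injective)
  have h3 : ∀ k : ZNonzero, ENNReal.ofReal (|((k : ℤ) : ℝ)| ^ (-r)) ^ q
      = ENNReal.ofReal (|((k : ℤ) : ℝ)| ^ (-(r * q))) := fun k => by
    rw [ENNReal.ofReal_rpow_of_nonneg (by positivity) hq.le, ← Real.rpow_mul (abs_nonneg _)]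
    congr 2; ring
  simp only [h3]
  exact h2.tsum_ofReal_ne_top

/-- Comparison of Fourier-Lebesgue sums through Hölder's inequality. -/
theorem tsum_rpow_mul_le_flNorm {s p q r : ℝ} (hpq : p.HolderConjugate q) (a : ℤ → ℂ) :
    ∑' k : ZNonzero, ENNReal.ofReal (|((k : ℤ) : ℝ)| ^ (-r)) * ‖a k‖ₑ
      ≤ ellNorm q (fun k : ZNonzero => ENNReal.ofReal (|((k : ℤ) : ℝ)| ^ (-(r + s))))
        * flNorm s p a := by
  rw [flNorm_eq_ellNorm]
  refine le_trans (le_of_eq (tsum_congr fun k => ?_)) (tsum_mul_le_ellNorm hpq.symm _ _)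
  have := one_le_abs_znonzero k
  rw [← mul_assoc, ← ENNReal.ofReal_mul (by positivity), ← Real.rpow_add (by linarith)]
  congr 3; ring

/-- `∑ |a_k| / |k|` is controlled by the Fourier-Lebesgue norm. -/
theorem exists_tsum_div_le_flNorm {s p : ℝ} (hs : 0 ≤ s) (hp : 1 < p) :
    ∃ C : ℝ, 0 < C ∧ ∀ a : ℤ → ℂ,
      ∑' k : ZNonzero, ‖a k‖ₑ / ‖((k : ℤ) : ℂ)‖ₑ ≤ ENNReal.ofReal C * flNorm s p a := by
  have hpq := Real.HolderConjugate.conjExponent hp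
  set q := p.conjExponent
  -- Since s ≥ 0 and q > 1, (1 + s) q > 1.
  have hfin := ellNorm_rpow_neg_lt_top (r := 1 + s) hpq.symm.pos (by
    have := hpq.symm.lt; nlinarith)
  set c := ellNorm q (fun k : ZNonzero => ENNReal.ofReal (|((k : ℤ) : ℝ)| ^ (-(1 + s))))
  refine ⟨c.toReal + 1, by positivity, fun a => ?_⟩
  have h := tsum_rpow_mul_le_flNorm (s := s) (r := 1) hpq a
  refine le_trans (le_of_eq (tsum_congr fun k => ?_)) (h.trans ?_)
  · rw [ENNReal.div_eq_inv_mul, ← ofReal_norm ((k : ℤ) : ℂ),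
      ← ENNReal.ofReal_inv_of_pos (by have := one_le_abs_znonzero k; simpa using k.2),
      Real.rpow_neg_one]
    simp
  · gcongr
    exact (ENNReal.ofReal_toReal hfin.ne).ge.trans
      (ENNReal.ofReal_le_ofReal (le_add_of_nonneg_right zero_le_one))

/-- The Fourier-Lebesgue space embeds into `ℓ²`. -/
theorem exists_ellNorm_two_le_flNorm {s p : ℝ}
    (hsp : (1 / 2 - 1 / p < s ∧ 2 < p) ∨ (0 ≤ s ∧ p = 2)) :
    ∃ C : ℝ, 0 < C ∧ ∀ a : ℤ → ℂ,
      ellNorm 2 (fun k : ZNonzero => ‖a k‖ₑ) ≤ ENNReal.ofReal C * flNorm s p a := by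
  rcases hsp with ⟨hs, hp⟩ | ⟨hs, rfl⟩
  · have hp0 : 0 < p := by linarith
    have hpq := Real.HolderConjugate.conjExponent (show 1 < p / 2 by linarith)
    set q := (p / 2).conjExponent
    -- Hölder is applied to |a_k|² with exponents p/2 and q. Summability needs 2s > 1/q = 1 - 2/p,
    -- which is exactly s > 1/2 - 1/p.
    have hfin := ellNorm_rpow_neg_lt_top (r := 2 * s) hpq.symm.pos (by
      have h1 := hpq.inv_add_inv_eq_one
      have h2 := hpq.symm.pos
      have h3 : q⁻¹ < 2 * s := by
        rw [inv_div] at h1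
        have : 2 / p = 2 * (1 / p) := by ring
        linarith
      calc (1 : ℝ) = q⁻¹ * q := (inv_mul_cancel₀ h2.ne').symm
        _ < _ := by gcongr)
    set c := ellNorm q (fun k : ZNonzero => ENNReal.ofReal (|((k : ℤ) : ℝ)| ^ (-(2 * s))))
    refine ⟨c.toReal ^ (1 / 2 : ℝ) + 1, by positivity, fun a => ?_⟩
    have h := tsum_mul_le_ellNorm hpq.symm
      (fun k : ZNonzero => ENNReal.ofReal (|((k : ℤ) : ℝ)| ^ (-(2 * s))))
      (fun k : ZNonzero => (ENNReal.ofReal (|((k : ℤ) : ℝ)| ^ s) * ‖a k‖ₑ) ^ (2 : ℝ))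
    have e1 : ∀ k : ZNonzero, ENNReal.ofReal (|((k : ℤ) : ℝ)| ^ (-(2 * s))) *
        (ENNReal.ofReal (|((k : ℤ) : ℝ)| ^ s) * ‖a k‖ₑ) ^ (2 : ℝ) = ‖a k‖ₑ ^ (2 : ℝ) := by
      intro k
      have := one_le_abs_znonzero k
      rw [ENNReal.mul_rpow_of_nonneg _ _ (by norm_num),
        ENNReal.ofReal_rpow_of_nonneg (by positivity) (by norm_num), ← mul_assoc,
        ← ENNReal.ofReal_mul (by positivity), ← Real.rpow_mul (by positivity),
        ← Real.rpow_add (by linarith)]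
      rw [show -(2 * s) + s * 2 = 0 by ring]; simp
    have e2 : ellNorm (p / 2)
        (fun k : ZNonzero => (ENNReal.ofReal (|((k : ℤ) : ℝ)| ^ s) * ‖a k‖ₑ) ^ (2 : ℝ))
        = flNorm s p a ^ (2 : ℝ) := by
      simp only [ellNorm, flNorm, ← ENNReal.rpow_mul]
      congr 1
      · rw [show (2 : ℝ) * (p / 2) = p by ring]
      · field_simp
    simp only [e1] at h
    rw [e2] at h
    have h' := ENNReal.rpow_le_rpow h (show (0 : ℝ) ≤ 1 / 2 by norm_num)
    refine h'.trans ?_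
    rw [ENNReal.mul_rpow_of_nonneg _ _ (by norm_num), ← ENNReal.rpow_mul]
    norm_num
    gcongr
    change c ^ (1 / 2 : ℝ) ≤ _
    rw [← ENNReal.ofReal_toReal hfin.ne, ENNReal.ofReal_rpow_of_nonneg (by positivity)
      (by norm_num)]
    exact ENNReal.ofReal_le_ofReal (by simp)
  · refine ⟨1, one_pos, fun a => ?_⟩
    rw [ENNReal.ofReal_one, one_mul, flNorm_eq_ellNorm]
    refine ellNorm_mono (by norm_num) fun k => ?_
    refine le_mul_of_one_le_left' ?_
    rw [ENNReal.one_le_ofReal]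
    exact Real.one_le_rpow (one_le_abs_znonzero k) hs

/-! ### Integral equations with small Lipschitz nonlinearities -/

section IntegralEquation

variable {E : Type*} [NormedAddCommGroup E]

/-- A time-dependent nonlinearity vanishing at `0`, jointly continuous and `1/8`-Lipschitz on the
closed ball of radius `ρ`. -/
structure IsSmallLipschitz (ρ : ℝ) (F : ℝ → E → E) : Prop where
  zero : ∀ t, F t 0 = 0
  lipschitz : ∀ t, ∀ x ∈ Metric.closedBall (0 : E) ρ, ∀ y ∈ Metric.closedBall (0 : E) ρ,
    ‖F t x - F t y‖ ≤ 1 / 8 * ‖x - y‖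
  continuousOn : ContinuousOn (Function.uncurry F) (univ ×ˢ Metric.closedBall (0 : E) ρ)

theorem IsSmallLipschitz.norm_le {ρ : ℝ} {F : ℝ → E → E} (hF : IsSmallLipschitz ρ F) (t : ℝ)
    {x : E} (hx : ‖x‖ ≤ ρ) : ‖F t x‖ ≤ 1 / 8 * ‖x‖ := by
  have h0 : 0 ≤ ρ := (norm_nonneg x).trans hx
  simpa [hF.zero] using hF.lipschitz t x (by simpa using hx) 0 (by simpa using h0)

theorem IsSmallLipschitz.comp_continuousOn {ρ : ℝ} {F : ℝ → E → E} (hF : IsSmallLipschitz ρ F)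
    {x : ℝ → E} {u : Set ℝ} (hx : ContinuousOn x u) (hρ : ∀ t ∈ u, ‖x t‖ ≤ ρ) :
    ContinuousOn (fun t => F t (x t)) u :=
  hF.continuousOn.comp (continuousOn_id.prodMk hx) fun t ht => ⟨mem_univ _, by simpa using hρ t ht⟩

theorem intervalIntegrable_of_continuousOn_Icc {x : ℝ → E} {t : ℝ} (ht : 0 ≤ t)
    (hx : ContinuousOn x (Icc 0 t)) : IntervalIntegrable x volume 0 t :=
  ContinuousOn.intervalIntegrable (by rwa [uIcc_of_le ht])

theorem norm_add_sub_add_le (a b c d : E) : ‖a + b - c + d‖ ≤ ‖a‖ + ‖b‖ + ‖c‖ + ‖d‖ := by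
  have h1 := norm_add_le (a + b - c) d
  have h2 := norm_sub_le (a + b) c
  have h3 := norm_add_le a b
  linarith

variable [NormedSpace ℝ E]

/-- The integral equation `x(t) = φ + F(t, x(t)) - F(0, φ) + ∫₀ᵗ K(t', x(t')) dt'` at time `t`. -/
def SolvesAt (F K : ℝ → E → E) (φ : E) (x : ℝ → E) (t : ℝ) : Prop :=
  x t = φ + F t (x t) - F 0 φ + ∫ t' in (0 : ℝ)..t, K t' (x t')

/-- At a maximum point the hypothesis gives D ≤ A + D/4. The quarter is 1/8 from the boundary term
plus 1/8 from the integral over a time at most 1. -/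
theorem le_of_le_add_quarter_sup {d : ℝ → ℝ} {τ A : ℝ} (hτ : 0 ≤ τ)
    (hd : ContinuousOn d (Icc 0 τ))
    (h : ∀ t ∈ Icc 0 τ, ∀ D, (∀ t' ∈ Icc 0 τ, d t' ≤ D) → d t ≤ A + D / 4) :
    ∀ t ∈ Icc 0 τ, d t ≤ 4 / 3 * A := by
  obtain ⟨t₀, ht₀, hmax⟩ := isCompact_Icc.exists_isMaxOn (nonempty_Icc.2 hτ) hd
  intro t ht
  have h1 := h t₀ ht₀ (d t₀) fun t' ht' => hmax ht'
  have h2 : d t ≤ d t₀ := hmax ht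
  linarith

theorem norm_intervalIntegral_le {g : ℝ → E} {t C : ℝ} (ht : t ∈ Icc (0 : ℝ) 1) (hC : 0 ≤ C)
    (hg : ∀ t' ∈ Icc 0 t, ‖g t'‖ ≤ C) : ‖∫ t' in (0 : ℝ)..t, g t'‖ ≤ C := by
  have h := intervalIntegral.norm_integral_le_of_norm_le_const (a := 0) (b := t) (f := g) (C := C)
    (fun t' ht' => hg t' (by rw [uIoc_of_le ht.1] at ht'; exact Ioc_subset_Icc_self ht'))
  refine h.trans ?_
  rw [sub_zero, abs_of_nonneg ht.1]
  exact mul_le_of_le_one_right hC ht.2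

/-- A priori bound for a bounded linear operator applied to a solution. -/
theorem norm_clm_le_of_solvesAt [CompleteSpace E] (L : E →L[ℝ] E) {F K : ℝ → E → E}
    {ρ τ : ℝ} (hτ : τ ∈ Icc (0 : ℝ) 1) (hK : IsSmallLipschitz ρ K)
    (hLF : ∀ t x, ‖x‖ ≤ ρ → ‖L (F t x)‖ ≤ 1 / 8 * ‖L x‖)
    (hLK : ∀ t x, ‖x‖ ≤ ρ → ‖L (K t x)‖ ≤ 1 / 8 * ‖L x‖)
    {φ : E} (hφ : ‖φ‖ ≤ ρ) {x : ℝ → E} (hx : ContinuousOn x (Icc 0 τ))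
    (hxρ : ∀ t ∈ Icc 0 τ, ‖x t‖ ≤ ρ) (heq : ∀ t ∈ Icc 0 τ, SolvesAt F K φ x t) :
    ∀ t ∈ Icc 0 τ, ‖L (x t)‖ ≤ 3 / 2 * ‖L φ‖ := by
  -- The data contribute φ and F(0, φ), hence 1 + 1/8; then 4/3 · 9/8 = 3/2.
  have key := le_of_le_add_quarter_sup (d := fun t => ‖L (x t)‖) (A := 9 / 8 * ‖L φ‖) hτ.1
    (L.continuous.comp_continuousOn hx).norm ?_
  · intro t ht
    have := key t ht
    linarith
  intro t ht D hD
  have hsub : Icc 0 t ⊆ Icc 0 τ := Icc_subset_Icc_right ht.2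
  have hD0 : 0 ≤ D := (norm_nonneg _).trans (hD t ht)
  have hint : IntervalIntegrable (fun t' => K t' (x t')) volume 0 t :=
    intervalIntegrable_of_continuousOn_Icc ht.1
      (hK.comp_continuousOn (hx.mono hsub) fun t' ht' => hxρ t' (hsub ht'))
  have e : L (x t) = L φ + L (F t (x t)) - L (F 0 φ) + ∫ t' in (0 : ℝ)..t, L (K t' (x t')) := by
    rw [L.intervalIntegral_comp_comm hint, ← map_add, ← map_sub, ← map_add]
    exact congrArg L (heq t ht)
  have h1 := hLF t (x t) (hxρ t ht)
  have h2 := hLF 0 φ hφ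
  have h3 : ‖∫ t' in (0 : ℝ)..t, L (K t' (x t'))‖ ≤ 1 / 8 * D :=
    norm_intervalIntegral_le ⟨ht.1, ht.2.trans hτ.2⟩ (by positivity) fun t' ht' =>
      (hLK t' _ (hxρ t' (hsub ht'))).trans (by gcongr; exact hD t' (hsub ht'))
  have h4 := hD t ht
  have h5 : ‖L (x t)‖ ≤ ‖L φ‖ + ‖L (F t (x t))‖ + ‖L (F 0 φ)‖
      + ‖∫ t' in (0 : ℝ)..t, L (K t' (x t'))‖ := by
    rw [e]
    exact norm_add_sub_add_le _ _ _ _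
  linarith

/-- Solutions with small data stay small. -/
theorem norm_le_of_solvesAt [CompleteSpace E] {F K : ℝ → E → E} {ρ : ℝ} (hρ : 0 < ρ)
    (hF : IsSmallLipschitz ρ F) (hK : IsSmallLipschitz ρ K) {φ : E} (hφ : ‖φ‖ ≤ ρ / 2)
    {x : ℝ → E} (hx : ContinuousOn x (Icc 0 1)) (hx0 : x 0 = φ)
    (heq : ∀ t ∈ Icc (0 : ℝ) 1, (∀ t' ∈ Icc 0 t, ‖x t'‖ ≤ ρ) → SolvesAt F K φ x t) :
    ∀ t ∈ Icc (0 : ℝ) 1, ‖x t‖ ≤ 3 / 2 * ‖φ‖ := by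
  have step : ∀ τ ∈ Icc (0 : ℝ) 1, (∀ t ∈ Icc 0 τ, ‖x t‖ ≤ ρ) →
      ∀ t ∈ Icc 0 τ, ‖x t‖ ≤ 3 / 2 * ‖φ‖ := by
    intro τ hτ hb
    refine norm_clm_le_of_solvesAt (ContinuousLinearMap.id ℝ E) hτ hK
      (fun t y hy => hF.norm_le t hy) (fun t y hy => hK.norm_le t hy) (by linarith)
      (hx.mono (Icc_subset_Icc_right hτ.2)) hb ?_
    intro t ht
    exact heq t ⟨ht.1, ht.2.trans hτ.2⟩ fun t' ht' => hb t' ⟨ht'.1, ht'.2.trans ht.2⟩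
  -- Continuous induction: as long as the bound ρ holds it improves to 3/2 · ρ/2 < ρ, so it survives
  -- slightly beyond.
  have hall : Icc (0 : ℝ) 1 ⊆ {t | ‖x t‖ ≤ ρ} := by
    refine IsClosed.Icc_subset_of_forall_mem_nhdsGT_of_Icc_subset ?_ ?_ ?_
    · have := hx.norm.preimage_isClosed_of_isClosed isClosed_Icc (isClosed_Iic (a := ρ))
      rwa [inter_comm] at this
    · simp only [mem_ofPred_eq, hx0]; linarith
    · intro t ht hsub
      have hlt : ‖x t‖ < ρ := by
        have := step t ⟨ht.1, ht.2.le⟩ hsub t ⟨ht.1, le_rfl⟩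
        linarith
      have h1 : ∀ᶠ t' in 𝓝[Icc 0 1] t, ‖x t'‖ < ρ :=
        (hx.norm t ⟨ht.1, ht.2.le⟩).eventually_lt_const hlt
      have h2 : 𝓝[>] t ≤ 𝓝[Icc 0 1] t := by
        rw [← nhdsWithin_Ioc_eq_nhdsGT ht.2]
        exact nhdsWithin_mono _ fun u hu => ⟨ht.1.trans hu.1.le, hu.2⟩
      exact Eventually.mono (h2 h1) fun t' ht' => le_of_lt ht'
  exact step 1 (by simp) fun t ht => hall ht

/-- In the difference of two solutions the data terms cancel, so the absorption bound applies with A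
= 0. -/
theorem eqOn_of_solvesAt {F K : ℝ → E → E} {ρ : ℝ}
    (hF : IsSmallLipschitz ρ F) (hK : IsSmallLipschitz ρ K) {φ : E} {x y : ℝ → E}
    (hx : ContinuousOn x (Icc 0 1)) (hy : ContinuousOn y (Icc 0 1))
    (hxρ : ∀ t ∈ Icc (0 : ℝ) 1, ‖x t‖ ≤ ρ) (hyρ : ∀ t ∈ Icc (0 : ℝ) 1, ‖y t‖ ≤ ρ)
    (hxe : ∀ t ∈ Icc (0 : ℝ) 1, SolvesAt F K φ x t)
    (hye : ∀ t ∈ Icc (0 : ℝ) 1, SolvesAt F K φ y t) : EqOn x y (Icc 0 1) := by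
  have key := le_of_le_add_quarter_sup (d := fun t => ‖x t - y t‖) (A := 0) zero_le_one
    (hx.sub hy).norm ?_
  · intro t ht
    have := key t ht
    rw [mul_zero] at this
    exact sub_eq_zero.1 (norm_le_zero_iff.1 this)
  intro t ht D hD
  have hD0 : 0 ≤ D := (norm_nonneg _).trans (hD t ht)
  have hsub : Icc 0 t ⊆ Icc 0 1 := Icc_subset_Icc_right ht.2
  have hint : ∀ z : ℝ → E, ContinuousOn z (Icc 0 1) → (∀ t ∈ Icc (0 : ℝ) 1, ‖z t‖ ≤ ρ) →
      IntervalIntegrable (fun t' => K t' (z t')) volume 0 t := fun z hz hzρ =>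
    intervalIntegrable_of_continuousOn_Icc ht.1
      (hK.comp_continuousOn (hz.mono hsub) fun t' ht' => hzρ t' (hsub ht'))
  have hlip : ∀ {G : ℝ → E → E}, IsSmallLipschitz ρ G → ∀ t ∈ Icc (0 : ℝ) 1,
      ‖G t (x t) - G t (y t)‖ ≤ 1 / 8 * D := fun hG t ht =>
    (hG.lipschitz t _ (by simpa using hxρ t ht) _ (by simpa using hyρ t ht)).trans
      (by gcongr; exact hD t ht)
  have e : x t - y t = (F t (x t) - F t (y t))
      + ∫ t' in (0 : ℝ)..t, (K t' (x t') - K t' (y t')) := by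
    rw [intervalIntegral.integral_sub (hint x hx hxρ) (hint y hy hyρ)]
    nth_rewrite 1 [hxe t ht, hye t ht]
    abel
  have h3 : ‖∫ t' in (0 : ℝ)..t, (K t' (x t') - K t' (y t'))‖ ≤ 1 / 8 * D :=
    norm_intervalIntegral_le ht (by positivity) fun t' ht' => hlip hK t' (hsub ht')
  have h4 := hlip hF t ht
  have h5 : ‖x t - y t‖ ≤ _ := e ▸ norm_add_le _ _
  linarith

/-- Existence of small solutions by the contraction principle. -/
theorem exists_solvesAt [CompleteSpace E] {F K : ℝ → E → E} {ρ : ℝ} (hρ : 0 < ρ)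
    (hF : IsSmallLipschitz ρ F) (hK : IsSmallLipschitz ρ K) {φ : E} (hφ : ‖φ‖ ≤ ρ / 2) :
    ∃ x : ℝ → E, Continuous x ∧ (∀ t, ‖x t‖ ≤ ρ) ∧ ∀ t ∈ Icc (0 : ℝ) 1, SolvesAt F K φ x t := by
  let X := C(Icc (0 : ℝ) 1, E)
  let Y := Metric.closedBall (0 : X) ρ
  -- Constant extension outside [0, 1] gives functions on all of ℝ that remain continuous and in the
  -- ball.
  let path : Y → ℝ → E := fun v t => (v : X) (projIcc 0 1 zero_le_one t)
  have hpc : ∀ v, Continuous (path v) := fun v => (v : X).continuous.comp continuous_projIcc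
  have hpn : ∀ v t, ‖path v t‖ ≤ ρ := fun v t =>
    ((v : X).norm_coe_le_norm _).trans (mem_closedBall_zero_iff.1 v.2)
  have hpd : ∀ v w t, ‖path v t - path w t‖ ≤ dist v w := fun v w t => by
    rw [← dist_eq_norm]
    exact ContinuousMap.dist_apply_le_dist _
  have hcomp : ∀ {G : ℝ → E → E}, IsSmallLipschitz ρ G → ∀ v,
      Continuous fun t => G t (path v t) := fun hG v => by
    rw [← continuousOn_univ]
    exact hG.comp_continuousOn (hpc v).continuousOn fun t _ => hpn v t
  have hint : ∀ v t, IntervalIntegrable (fun t' => K t' (path v t')) volume 0 t := fun v t =>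
    (hcomp hK v).intervalIntegrable _ _
  let Φ : Y → ℝ → E := fun v t =>
    φ + F t (path v t) - F 0 φ + ∫ t' in (0 : ℝ)..t, K t' (path v t')
  have hΦc : ∀ v, Continuous (Φ v) := fun v =>
    ((continuous_const.add (hcomp hF v)).sub continuous_const).add
      (intervalIntegral.continuous_primitive
        (fun a b => (hcomp hK v).intervalIntegrable a b) 0)
  -- The four terms add up to at most (1/2 + 1/8 + 1/16 + 1/8) ρ.
  have hΦn : ∀ v, ∀ t ∈ Icc (0 : ℝ) 1, ‖Φ v t‖ ≤ ρ := by
    intro v t ht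
    have h1 := hF.norm_le t (hpn v t)
    have h2 := hF.norm_le 0 (hφ.trans (by linarith))
    have h3 : ‖∫ t' in (0 : ℝ)..t, K t' (path v t')‖ ≤ 1 / 8 * ρ :=
      norm_intervalIntegral_le ht (by positivity) fun t' _ =>
        (hK.norm_le t' (hpn v t')).trans (by gcongr; exact hpn v t')
    have h4 := hpn v t
    have h5 : ‖Φ v t‖ ≤ ‖φ‖ + ‖F t (path v t)‖ + ‖F 0 φ‖
        + ‖∫ t' in (0 : ℝ)..t, K t' (path v t')‖ :=
      norm_add_sub_add_le _ _ _ _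
    linarith
  let f : Y → Y := fun v => ⟨⟨fun t => Φ v t, (hΦc v).comp continuous_subtype_val⟩, by
    rw [mem_closedBall_zero_iff, ContinuousMap.norm_le _ hρ.le]
    exact fun t => hΦn v t t.2⟩
  have hf : ContractingWith (1 / 2) f := by
    refine ⟨by norm_num, LipschitzWith.of_dist_le_mul fun v w => ?_⟩
    change dist (f v : X) (f w : X) ≤ _
    rw [ContinuousMap.dist_le (by positivity)]
    intro t
    rw [dist_eq_norm]
    have hd0 : 0 ≤ dist v w := dist_nonneg
    have hlip : ∀ {G : ℝ → E → E}, IsSmallLipschitz ρ G → ∀ t,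
        ‖G t (path v t) - G t (path w t)‖ ≤ 1 / 8 * dist v w := fun hG t =>
      (hG.lipschitz t _ (by simpa using hpn v t) _ (by simpa using hpn w t)).trans
        (by gcongr; exact hpd v w t)
    have e : (f v : X) t - (f w : X) t = (F t (path v t) - F t (path w t))
        + ∫ t' in (0 : ℝ)..t, (K t' (path v t') - K t' (path w t')) := by
      rw [intervalIntegral.integral_sub (hint v t) (hint w t)]
      change Φ v t - Φ w t = _
      simp only [Φ]
      abel
    have h3 : ‖∫ t' in (0 : ℝ)..(t : ℝ), (K t' (path v t') - K t' (path w t'))‖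
        ≤ 1 / 8 * dist v w :=
      norm_intervalIntegral_le t.2 (by positivity) fun t' _ => hlip hK t'
    have h4 := hlip hF t
    have h5 : ‖(f v : X) t - (f w : X) t‖ ≤ _ := e ▸ norm_add_le _ _
    have : ((1 / 2 : NNReal) : ℝ) = 1 / 2 := by norm_num
    rw [this]
    linarith
  have : Nonempty Y := ⟨⟨0, Metric.mem_closedBall_self hρ.le⟩⟩
  have : CompleteSpace Y := Metric.isClosed_closedBall.completeSpace_coe
  have hfix := hf.fixedPoint_isFixedPt
  set v := hf.fixedPoint f
  refine ⟨path v, hpc v, hpn v, fun t ht => ?_⟩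
  have h1 : path v t = (v : X) ⟨t, ht⟩ := by simp only [path, projIcc_of_mem zero_le_one ht]
  have h2 : (v : X) ⟨t, ht⟩ = Φ v t := by
    conv_lhs => rw [← hfix.eq]
    rfl
  exact h1.trans h2

end IntegralEquation

/-! ### The Banach space of weighted Fourier coefficients -/

/-- The space `ℓ^p(ℤ₀)`, which parametrizes `FL₀^{s,p}` through `x_k = |k|^s f_k`. -/
abbrev SeqSpace (p : ℝ) : Type := lp (fun _ : ZNonzero => ℂ) (ENNReal.ofReal p)

instance fact_one_le_ofReal {p : ℝ} [Fact (1 ≤ p)] : Fact (1 ≤ ENNReal.ofReal p) :=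
  ⟨ENNReal.one_le_ofReal.2 Fact.out⟩

section SeqSpace

theorem exponent_pos {p : ℝ} [hp : Fact (1 ≤ p)] : 0 < p := zero_lt_one.trans_le hp.out

theorem toReal_exponent {p : ℝ} [Fact (1 ≤ p)] : (ENNReal.ofReal p).toReal = p :=
  ENNReal.toReal_ofReal exponent_pos.le

variable {p : ℝ}

/-- The Fourier coefficients `|k|^{-s} x_k` parametrized by `x ∈ ℓ^p(ℤ₀)`. -/
def seq (s : ℝ) : SeqSpace p →ₗ[ℂ] (ℤ → ℂ) where
  toFun x k := if h : k ≠ 0 then ((|(k : ℝ)| ^ (-s) : ℝ) : ℂ) * x ⟨k, h⟩ else 0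
  map_add' x y := by
    ext k
    by_cases h : k = 0 <;> simp [h, mul_add]
  map_smul' c x := by
    ext k
    by_cases h : k = 0 <;> simp [h, mul_left_comm]

theorem seq_zero_freq (s : ℝ) (x : SeqSpace p) : seq s x 0 = 0 := by simp [seq]

theorem seq_apply (s : ℝ) (x : SeqSpace p) (k : ZNonzero) :
    seq s x k = ((|((k : ℤ) : ℝ)| ^ (-s) : ℝ) : ℂ) * x k := by
  simp [seq, k.2]

theorem apply_eq_seq (s : ℝ) (x : SeqSpace p) (k : ZNonzero) :
    x k = ((|((k : ℤ) : ℝ)| ^ s : ℝ) : ℂ) * seq s x k := by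
  have := one_le_abs_znonzero k
  rw [seq_apply, ← mul_assoc, ← Complex.ofReal_mul, ← Real.rpow_add (by linarith)]
  simp

theorem enorm_rpow_mul (s : ℝ) (k : ZNonzero) (z : ℂ) :
    ‖((|((k : ℤ) : ℝ)| ^ s : ℝ) : ℂ) * z‖ₑ = ENNReal.ofReal (|((k : ℤ) : ℝ)| ^ s) * ‖z‖ₑ := by
  rw [enorm_mul, ← ofReal_norm (((|((k : ℤ) : ℝ)| ^ s : ℝ) : ℂ)), Complex.norm_real,
    Real.norm_of_nonneg (by positivity)]

theorem seq_injective (s : ℝ) : Function.Injective (seq (p := p) s) := by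
  intro x y h
  refine lp.ext (funext fun k => ?_)
  rw [apply_eq_seq s x k, apply_eq_seq s y k, h]

variable [Fact (1 ≤ p)]

theorem memℓp_iff_ellNorm_lt_top {x : ZNonzero → ℂ} :
    Memℓp x (ENNReal.ofReal p) ↔ ellNorm p (fun k => ‖x k‖ₑ) < ∞ := by
  have hp0 : 0 < p := exponent_pos
  rw [memℓp_gen_iff (by rwa [toReal_exponent]), toReal_exponent, ellNorm,
    ENNReal.rpow_lt_top_iff_of_pos (by positivity), lt_top_iff_ne_top]
  have : ∀ k, ‖x k‖ₑ ^ p = ENNReal.ofReal (‖x k‖ ^ p) := fun k => by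
    rw [← ofReal_norm, ENNReal.ofReal_rpow_of_nonneg (norm_nonneg _) hp0.le]
  simp only [this]
  constructor
  · exact fun h => h.tsum_ofReal_ne_top
  · intro h
    refine (ENNReal.summable_toReal h).congr fun k => ?_
    rw [ENNReal.toReal_ofReal (by positivity)]

theorem enorm_eq_ellNorm (x : SeqSpace p) : ‖x‖ₑ = ellNorm p (fun k => ‖x k‖ₑ) := by
  have hp0 : 0 < p := exponent_pos
  have hs : Summable fun k => ‖x k‖ ^ p := by
    have := (lp.memℓp x).summable (by rwa [toReal_exponent])
    rwa [toReal_exponent] at this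
  rw [← ofReal_norm, lp.norm_eq_tsum_rpow (by rwa [toReal_exponent]), toReal_exponent,
    ← ENNReal.ofReal_rpow_of_nonneg (tsum_nonneg fun k => by positivity) (by positivity),
    ENNReal.ofReal_tsum_of_nonneg (fun k => by positivity) hs, ellNorm]
  congr 2
  ext k
  rw [← ofReal_norm, ENNReal.ofReal_rpow_of_nonneg (norm_nonneg _) hp0.le]

/-- The element of `ℓ^p(ℤ₀)` with given coordinates. -/
def seqMk (x : ZNonzero → ℂ) (h : ellNorm p (fun k => ‖x k‖ₑ) < ∞) : SeqSpace p :=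
  ⟨x, memℓp_iff_ellNorm_lt_top.2 h⟩

theorem seqMk_apply (x : ZNonzero → ℂ) (h : ellNorm p (fun k => ‖x k‖ₑ) < ∞) (k : ZNonzero) :
    seqMk x h k = x k := rfl

theorem flNorm_seq (s : ℝ) (x : SeqSpace p) : flNorm s p (seq s x) = ‖x‖ₑ := by
  rw [enorm_eq_ellNorm, flNorm_eq_ellNorm]
  congr 1
  ext k
  rw [apply_eq_seq s x k, enorm_rpow_mul]

theorem exists_seq_eq {s : ℝ} {a : ℤ → ℂ} (h0 : a 0 = 0) (h : flNorm s p a < ∞) :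
    ∃ x : SeqSpace p, seq s x = a := by
  refine ⟨seqMk (fun k => ((|((k : ℤ) : ℝ)| ^ s : ℝ) : ℂ) * a k) ?_, ?_⟩
  · simpa only [enorm_rpow_mul, flNorm_eq_ellNorm] using h
  · ext k
    by_cases hk : k = 0
    · rw [hk, seq_zero_freq, h0]
    · have := one_le_abs_znonzero ⟨k, hk⟩
      simp only at this
      rw [seq_apply s _ ⟨k, hk⟩, seqMk_apply, ← mul_assoc, ← Complex.ofReal_mul,
        ← Real.rpow_add (by linarith)]
      simp

/-- Multiplication by a bounded sequence. -/
def diag (c : ZNonzero → ℂ) (C : ℝ) (hc : ∀ k, ‖c k‖ ≤ C) : SeqSpace p →L[ℂ] SeqSpace p :=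
  have hb : ∀ x : SeqSpace p, ellNorm p (fun k => ‖c k * x k‖ₑ) ≤ ENNReal.ofReal C * ‖x‖ₑ := by
    intro x
    rw [enorm_eq_ellNorm, ← ellNorm_const_mul exponent_pos]
    refine ellNorm_mono exponent_pos.le fun k => ?_
    rw [enorm_mul]
    gcongr
    rw [← ofReal_norm]
    exact ENNReal.ofReal_le_ofReal (hc k)
  LinearMap.mkContinuous
    { toFun := fun x => seqMk (fun k => c k * x k)
        ((hb x).trans_lt (ENNReal.mul_lt_top ENNReal.ofReal_lt_top enorm_lt_top))
      map_add' := fun x y => lp.ext (funext fun k => mul_add (c k) (x k) (y k))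
      map_smul' := fun r x => lp.ext (funext fun k => mul_left_comm (c k) r (x k)) }
    C fun x => by
      by_cases hC : 0 ≤ C
      · refine (ENNReal.ofReal_le_ofReal_iff (by positivity)).1 ?_
        rw [ofReal_norm, ENNReal.ofReal_mul hC, ofReal_norm, enorm_eq_ellNorm]
        exact hb x
      · exact absurd ((norm_nonneg _).trans (hc ⟨1, one_ne_zero⟩)) hC

theorem diag_apply (c : ZNonzero → ℂ) (C : ℝ) (hc : ∀ k, ‖c k‖ ≤ C) (x : SeqSpace p)
    (k : ZNonzero) : diag c C hc x k = c k * x k := rfl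

theorem enorm_diag (c : ZNonzero → ℂ) (C : ℝ) (hc : ∀ k, ‖c k‖ ≤ C) (x : SeqSpace p) :
    ‖diag c C hc x‖ₑ = ellNorm p (fun k => ‖c k‖ₑ * ‖x k‖ₑ) := by
  rw [enorm_eq_ellNorm]
  simp only [diag_apply, enorm_mul]

/-! ### The linear propagator -/

/-- The symbol `e^{-ik²t}` of the linear propagator. -/
def phase (t : ℝ) (k : ℤ) : ℂ := Complex.exp (-Complex.I * (k : ℂ) ^ 2 * (t : ℂ))

theorem norm_phase (t : ℝ) (k : ℤ) : ‖phase t k‖ = 1 := by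
  have : phase t k = Complex.exp (((-(k : ℝ) ^ 2 * t : ℝ) : ℂ) * Complex.I) := by
    unfold phase; congr 1; push_cast; ring
  rw [this, Complex.norm_exp_ofReal_mul_I]

theorem enorm_phase (t : ℝ) (k : ℤ) : ‖phase t k‖ₑ = 1 := by
  rw [← ofReal_norm, norm_phase, ENNReal.ofReal_one]

/-- The linear propagator on `ℓ^p(ℤ₀)`. -/
def propagator (t : ℝ) : SeqSpace p →L[ℂ] SeqSpace p :=
  diag (fun k => phase t k) 1 fun k => (norm_phase t k).le

theorem propagator_apply (t : ℝ) (x : SeqSpace p) (k : ZNonzero) :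
    propagator t x k = phase t k * x k := rfl

theorem seq_propagator (s t : ℝ) (x : SeqSpace p) :
    seq s (propagator t x) = fun k => phase t k * seq s x k := by
  ext k
  by_cases hk : k = 0
  · rw [hk, seq_zero_freq, seq_zero_freq, mul_zero]
  · have h1 := seq_apply s (propagator t x) ⟨k, hk⟩
    have h2 := seq_apply s x ⟨k, hk⟩
    simp only at h1 h2
    rw [h1, h2, propagator_apply]
    ring

theorem norm_propagator (t : ℝ) (x : SeqSpace p) : ‖propagator t x‖ = ‖x‖ := by
  have : ‖propagator t x‖ₑ = ‖x‖ₑ := by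
    rw [propagator, enorm_diag, enorm_eq_ellNorm]
    simp only [enorm_phase, one_mul]
  simpa [← ofReal_norm] using this

/-- Only strong continuity is available, as k² is unbounded. Finitely supported sequences are dense
because p < ∞, and isometry makes the approximation uniform in t. -/
theorem continuous_propagator_apply (x : SeqSpace p) : Continuous fun t => propagator t x := by
  classical
  have hs := lp.hasSum_single (E := fun _ : ZNonzero => ℂ) (p := ENNReal.ofReal p)
    ENNReal.ofReal_ne_top x
  have hu : TendstoUniformly
      (fun (u : Finset ZNonzero) t =>
        propagator t (∑ k ∈ u, lp.single (E := fun _ : ZNonzero => ℂ) (ENNReal.ofReal p) k (x k)))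
      (fun t => propagator t x) atTop := by
    rw [Metric.tendstoUniformly_iff]
    intro ε hε
    filter_upwards [Metric.tendsto_nhds.1 hs ε hε] with u hu t
    rw [dist_eq_norm, ← map_sub, norm_propagator, ← dist_eq_norm, dist_comm]
    exact hu
  refine hu.continuous (Frequently.of_forall fun u => ?_)
  simp only [map_sum]
  refine continuous_finsetSum _ fun k _ => ?_
  have : (fun t => propagator t (lp.single (E := fun _ : ZNonzero => ℂ) (ENNReal.ofReal p) k (x k)))
      = fun t => phase t k • lp.single (E := fun _ : ZNonzero => ℂ) (ENNReal.ofReal p) k (x k) := by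
    ext t : 1
    refine lp.ext (funext fun l => ?_)
    rw [propagator_apply, lp.coeFn_smul, Pi.smul_apply, smul_eq_mul]
    by_cases hl : l = k
    · rw [hl]
    · rw [lp.single_apply_ne _ _ _ hl, mul_zero, mul_zero]
  rw [this]
  have hc : Continuous fun t => phase t k := by
    unfold phase
    fun_prop
  exact hc.smul continuous_const

theorem continuous_propagator :
    Continuous fun q : ℝ × SeqSpace p => propagator q.1 q.2 := by
  have := continuous_prod_of_continuous_lipschitzWith
    (fun q : SeqSpace p × ℝ => propagator q.2 q.1) 1 continuous_propagator_apply
    (fun t => LipschitzWith.of_dist_le_mul fun x y => by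
      simp only [NNReal.coe_one, one_mul]
      rw [dist_eq_norm, ← map_sub, norm_propagator, ← dist_eq_norm])
  exact this.comp continuous_swap

/-- The nonlinearity `G` in the interaction picture. -/
def interaction (G : SeqSpace p → SeqSpace p) (t : ℝ) (x : SeqSpace p) : SeqSpace p :=
  propagator (-t) (G (propagator t x))

/-- Conjugation by isometries preserves the ball and the Lipschitz constant. -/
theorem isSmallLipschitz_interaction {G : SeqSpace p → SeqSpace p} {ρ : ℝ} (h0 : G 0 = 0)
    (hG : LipschitzOnWith (1 / 8) G (Metric.closedBall 0 ρ)) :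
    IsSmallLipschitz ρ (interaction G) := by
  have hmem : ∀ t, ∀ x ∈ Metric.closedBall (0 : SeqSpace p) ρ,
      propagator t x ∈ Metric.closedBall (0 : SeqSpace p) ρ := fun t x hx => by
    simpa [norm_propagator] using hx
  refine ⟨fun t => by simp [interaction, h0], fun t x hx y hy => ?_, ?_⟩
  · rw [interaction, interaction, ← map_sub, norm_propagator]
    have := hG.dist_le_mul _ (hmem t x hx) _ (hmem t y hy)
    rw [dist_eq_norm, dist_eq_norm, ← map_sub, norm_propagator] at this
    simpa using this
  · have h1 : ContinuousOn (fun q : ℝ × SeqSpace p => G (propagator q.1 q.2))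
        (univ ×ˢ Metric.closedBall (0 : SeqSpace p) ρ) :=
      hG.continuousOn.comp continuous_propagator.continuousOn fun q hq => hmem _ _ hq.2
    have h2 : ContinuousOn (fun q : ℝ × SeqSpace p => (-q.1, G (propagator q.1 q.2)))
        (univ ×ˢ Metric.closedBall (0 : SeqSpace p) ρ) :=
      (continuous_fst.neg.continuousOn).prodMk h1
    have h3 := continuous_propagator.comp_continuousOn h2
    simp only [Function.comp_def] at h3
    simpa only [Function.uncurry_def, interaction] using h3

end SeqSpace

/-! ### The multilinear terms of the normal form equation -/

/-- The scalar factor in front of the `n`-th term of the normal form equation. -/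
def coefN (n : ℕ) (m : ℤ) : ℂ := (-1) ^ n * (m : ℂ) / (2 ^ (n - 1) * (n.factorial : ℂ))

/-- The `n`-linear version of `termN n 0`. -/
def conv (n : ℕ) (a : Fin n → ℤ → ℂ) (m : ℤ) : ℂ :=
  coefN n m * ∑' k : Freq n m, ∏ j, a j (k.1 j) / (k.1 j : ℂ)

/-- The decay 1/(2^{n-1} n!) is given away: for small data geometric convergence suffices. -/
theorem enorm_coefN_le (n : ℕ) (m : ℤ) : ‖coefN n m‖ₑ ≤ ‖(m : ℂ)‖ₑ := by
  rw [← ofReal_norm, ← ofReal_norm]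
  refine ENNReal.ofReal_le_ofReal ?_
  rw [coefN, norm_div, norm_mul, norm_pow, norm_neg, norm_one, one_pow, one_mul]
  refine div_le_self (norm_nonneg _) ?_
  rw [norm_mul, norm_pow, Complex.norm_ofNat, Complex.norm_natCast]
  have h1 : (1 : ℝ) ≤ 2 ^ (n - 1) := one_le_pow₀ (by norm_num)
  have h2 : (1 : ℝ) ≤ n.factorial := by exact_mod_cast n.factorial_pos
  nlinarith

theorem enorm_div_intCast (z : ℂ) {k : ℤ} (hk : k ≠ 0) : ‖z / k‖ₑ = ‖z‖ₑ / ‖(k : ℂ)‖ₑ := by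
  rw [div_eq_mul_inv, enorm_mul, enorm_inv (by simpa using hk), div_eq_mul_inv]

theorem enorm_prod_div {n : ℕ} {m : ℤ} (a : Fin n → ℤ → ℂ) (k : Freq n m) :
    ‖∏ j, a j (k.1 j) / (k.1 j : ℂ)‖ₑ = ∏ j, ‖a j (k.1 j)‖ₑ / ‖(k.1 j : ℂ)‖ₑ := by
  rw [← ofReal_norm, norm_prod, ENNReal.ofReal_prod_of_nonneg fun _ _ => norm_nonneg _]
  refine Finset.prod_congr rfl fun j _ => ?_
  rw [ofReal_norm, enorm_div_intCast _ (k.2.1 j)]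

theorem enorm_conv_le (n : ℕ) (a : Fin n → ℤ → ℂ) (m : ℤ) :
    ‖conv n a m‖ₑ ≤ ‖(m : ℂ)‖ₑ *
      ∑' k : Freq n m, ∏ j, ‖a j (k.1 j)‖ₑ / ‖(k.1 j : ℂ)‖ₑ := by
  rw [conv, enorm_mul]
  refine mul_le_mul' (enorm_coefN_le n m) (enorm_tsum_le_tsum_enorm.trans_eq ?_)
  exact tsum_congr fun k => enorm_prod_div a k

/-- The bounds on Fourier-Lebesgue sequences behind all estimates. -/
structure FLBounds (s p C : ℝ) : Prop where
  s_nonneg : 0 ≤ s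
  C_nonneg : 0 ≤ C
  div_le : ∀ a : ℤ → ℂ,
    ∑' k : ZNonzero, ‖a k‖ₑ / ‖((k : ℤ) : ℂ)‖ₑ ≤ ENNReal.ofReal C * flNorm s p a
  two_le : ∀ a : ℤ → ℂ,
    ellNorm 2 (fun k : ZNonzero => ‖a k‖ₑ) ≤ ENNReal.ofReal C * flNorm s p a

theorem exists_flBounds {s p : ℝ}
    (hsp : (1 / 2 - 1 / p < s ∧ 2 < p) ∨ (0 ≤ s ∧ p = 2)) : ∃ C, FLBounds s p C := by
  have hs : 0 ≤ s ∧ 1 < p := by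
    rcases hsp with ⟨hs, hp⟩ | ⟨hs, hp⟩
    · have : 1 / p < 1 / 2 := one_div_lt_one_div_of_lt (by norm_num) hp
      constructor <;> linarith
    · constructor <;> linarith
  obtain ⟨C₁, h1, h1'⟩ := exists_tsum_div_le_flNorm hs.1 hs.2
  obtain ⟨C₂, h2, h2'⟩ := exists_ellNorm_two_le_flNorm hsp
  refine ⟨max C₁ C₂, hs.1, h1.le.trans (le_max_left _ _), fun a => (h1' a).trans ?_,
    fun a => (h2' a).trans ?_⟩
  · gcongr; exact le_max_left _ _
  · gcongr; exact le_max_right _ _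

/-- The norm with weight `|k|^s min(|k|, N)^σ`. -/
def truncNorm (s σ N p : ℝ) (a : ℤ → ℂ) : ℝ≥0∞ :=
  ellNorm p (fun k : ZNonzero => ENNReal.ofReal (truncWeight s σ N k) * ‖a k‖ₑ)

theorem truncNorm_zero (s N p : ℝ) (a : ℤ → ℂ) : truncNorm s 0 N p a = flNorm s p a := by
  simp only [truncNorm, truncWeight_zero_right, flNorm_eq_ellNorm]

theorem summable_rpow_mul_geometric (b : ℝ) :
    Summable fun n : ℕ => ((n + 2 : ℕ) : ℝ) ^ b * (1 / 2 : ℝ) ^ n := by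
  obtain ⟨k, hk⟩ := exists_nat_ge b
  have h := summable_pow_mul_geometric_of_norm_lt_one k (r := (1 / 2 : ℝ)) (by norm_num)
  have h2 := ((summable_nat_add_iff 2).2 h).mul_left 4
  refine Summable.of_nonneg_of_le (fun n => by positivity) (fun n => ?_) h2
  calc ((n + 2 : ℕ) : ℝ) ^ b * (1 / 2 : ℝ) ^ n ≤ ((n + 2 : ℕ) : ℝ) ^ (k : ℝ) * (1 / 2 : ℝ) ^ n := by
        gcongr
        push_cast; linarith [(Nat.cast_nonneg n : (0 : ℝ) ≤ n)]
    _ = _ := by rw [Real.rpow_natCast, pow_add (1 / 2 : ℝ)]; ring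

section Estimates

variable {s p C : ℝ}

/-- The summand of `conv` as a multilinear map. -/
def convSummand (s p : ℝ) {n : ℕ} (k : Fin n → ℤ) :
    MultilinearMap ℂ (fun _ : Fin n => SeqSpace p) ℂ :=
  (MultilinearMap.mkPiAlgebra ℂ (Fin n) ℂ).compLinearMap fun j =>
    ((k j : ℂ)⁻¹) • (LinearMap.proj (k j)).comp (seq s)

theorem convSummand_apply {n : ℕ} (k : Fin n → ℤ) (x : Fin n → SeqSpace p) :
    convSummand s p k x = ∏ j, seq s (x j) (k j) / (k j : ℂ) := by
  simp [convSummand, div_eq_inv_mul]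

theorem conv_seq_eq {n : ℕ} (x : Fin n → SeqSpace p) (m : ℤ) :
    conv n (fun j => seq s (x j)) m = coefN n m * ∑' k : Freq n m, convSummand s p k.1 x := by
  simp only [conv, convSummand_apply]

variable [Fact (1 ≤ p)]

/-- In each summand only one factor carries the additional σ; the others are measured in FL₀^{s,p}.
Persistence of regularity rests on this. -/
theorem truncNorm_conv_le (hC : FLBounds s p C) {σ N : ℝ} (hσ : 0 ≤ σ) (hN : 0 ≤ N) {n : ℕ}
    (a : Fin (n + 1) → ℤ → ℂ) :
    ellNorm p (fun m : ZNonzero => ENNReal.ofReal (truncWeight s σ N m) * ‖((m : ℤ) : ℂ)‖ₑ *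
        ∑' k : Freq (n + 1) m, ∏ j, ‖a j (k.1 j)‖ₑ / ‖(k.1 j : ℂ)‖ₑ)
      ≤ ENNReal.ofReal (((n + 1 : ℕ) : ℝ) ^ (1 + s + σ)) * ∑ i, truncNorm s σ N p (a i) *
          ∏ j, (ENNReal.ofReal C * flNorm s p (a (i.succAbove j))) := by
  refine (ellNorm_conv_le Fact.out
    (isConvWeight_truncWeight hC.s_nonneg hσ hN (Nat.succ_le_succ n.zero_le))
    (fun j l => ‖a j l‖ₑ)).trans ?_
  gcongr with i _ j
  · exact le_rfl
  · exact hC.div_le _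

theorem truncNorm_termN_le (hC : FLBounds s p C) {σ N : ℝ} (hσ : 0 ≤ σ) (hN : 0 ≤ N) (n : ℕ)
    (a : ℤ → ℂ) :
    truncNorm s σ N p (conv (n + 1) fun _ => a)
      ≤ ENNReal.ofReal (((n + 1 : ℕ) : ℝ) ^ (2 + s + σ)) * (ENNReal.ofReal C * flNorm s p a) ^ n
        * truncNorm s σ N p a := by
  refine le_trans (ellNorm_mono exponent_pos.le fun m => ?_)
    ((truncNorm_conv_le hC hσ hN fun _ : Fin (n + 1) => a).trans_eq ?_)
  · rw [mul_assoc]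
    gcongr
    exact enorm_conv_le _ _ _
  · simp only [Finset.prod_const, Finset.sum_const, Finset.card_univ, Fintype.card_fin,
      nsmul_eq_mul]
    have : ((n + 1 : ℕ) : ℝ≥0∞) = ENNReal.ofReal ((n + 1 : ℕ) : ℝ) :=
      (ENNReal.ofReal_natCast _).symm
    -- The n + 1 equal summands raise the exponent from 1 + s + σ to 2 + s + σ.
    rw [this, ← mul_assoc, ← ENNReal.ofReal_mul (by positivity),
      ← Real.rpow_add_one (by positivity), show 1 + s + σ + 1 = 2 + s + σ by ring]
    ring

/-- The multilinear estimate in `FL₀^{s,p}`. -/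
theorem flNorm_conv_le (hC : FLBounds s p C) (n : ℕ) (x : Fin (n + 1) → SeqSpace p) :
    ellNorm p (fun m : ZNonzero => ENNReal.ofReal (|((m : ℤ) : ℝ)| ^ s) * (‖((m : ℤ) : ℂ)‖ₑ *
        ∑' k : Freq (n + 1) m, ∏ j, ‖seq s (x j) (k.1 j)‖ₑ / ‖(k.1 j : ℂ)‖ₑ))
      ≤ ENNReal.ofReal (((n + 1 : ℕ) : ℝ) ^ (2 + s) * C ^ n) * ∏ j, ‖x j‖ₑ := by
  have h := truncNorm_conv_le hC le_rfl (zero_le_one (α := ℝ)) fun j => seq s (x j)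
  simp only [truncWeight_zero_right, truncNorm_zero, flNorm_seq, Finset.prod_mul_distrib,
    Finset.prod_const, Finset.card_univ, Fintype.card_fin] at h
  simp only [← mul_assoc] at h ⊢
  refine h.trans_eq ?_
  have e : ∀ i, ‖x i‖ₑ * ENNReal.ofReal C ^ n * ∏ j, ‖x (i.succAbove j)‖ₑ
      = ENNReal.ofReal C ^ n * ∏ j, ‖x j‖ₑ := fun i => by
    rw [Fin.prod_univ_succAbove _ i]; ring
  simp only [e, Finset.sum_const, Finset.card_univ, Fintype.card_fin, nsmul_eq_mul]
  have : ((n + 1 : ℕ) : ℝ≥0∞) = ENNReal.ofReal ((n + 1 : ℕ) : ℝ) :=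
    (ENNReal.ofReal_natCast _).symm
  have hC0 := hC.C_nonneg
  rw [this, ENNReal.ofReal_mul (by positivity), ENNReal.ofReal_pow hC0,
    show 2 + s = 1 + s + 0 + 1 by ring, Real.rpow_add_one (by positivity),
    ENNReal.ofReal_mul (by positivity)]
  ring

theorem summable_freq (hC : FLBounds s p C) (n : ℕ) (x : Fin (n + 1) → SeqSpace p) {m : ℤ}
    (hm : m ≠ 0) :
    Summable fun k : Freq (n + 1) m => ∏ j, seq s (x j) (k.1 j) / (k.1 j : ℂ) := by
  have h1 := (le_ellNorm exponent_pos _ ⟨m, hm⟩).trans (flNorm_conv_le hC n x)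
  have hlt : ENNReal.ofReal (((n + 1 : ℕ) : ℝ) ^ (2 + s) * C ^ n) * ∏ j, ‖x j‖ₑ < ∞ :=
    ENNReal.mul_lt_top ENNReal.ofReal_lt_top (ENNReal.prod_lt_top fun _ _ => enorm_lt_top)
  have h2 := h1.trans_lt hlt
  have hm1 := one_le_abs_znonzero ⟨m, hm⟩
  simp only at hm1
  have h3 : ∑' k : Freq (n + 1) m, ‖∏ j, seq s (x j) (k.1 j) / (k.1 j : ℂ)‖ₑ ≠ ∞ := by
    intro htop
    simp only [enorm_prod_div] at htop
    simp only at h2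
    -- The factors |m| and |m|^s are nonzero, so a divergent sum would make the finite norm
    -- infinite.
    rw [htop, ENNReal.mul_top (enorm_intCast_ne_zero hm), ENNReal.mul_top] at h2
    · exact lt_irrefl _ h2
    · rw [Ne, ENNReal.ofReal_eq_zero, not_le]; positivity
  exact Summable.of_enorm h3

theorem ellNorm_conv_seq_le (hC : FLBounds s p C) (n : ℕ) (x : Fin (n + 1) → SeqSpace p) :
    ellNorm p (fun m : ZNonzero =>
        ‖((|((m : ℤ) : ℝ)| ^ s : ℝ) : ℂ) * conv (n + 1) (fun j => seq s (x j)) m‖ₑ)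
      ≤ ENNReal.ofReal (((n + 1 : ℕ) : ℝ) ^ (2 + s) * C ^ n) * ∏ j, ‖x j‖ₑ := by
  refine (ellNorm_mono exponent_pos.le fun m => ?_).trans (flNorm_conv_le hC n x)
  rw [enorm_rpow_mul]
  gcongr
  exact enorm_conv_le _ _ _

/-- The multilinear map `E^{n+1} → E` with coefficients `conv (n + 1)`. -/
def convMultilinear (hC : FLBounds s p C) (n : ℕ) :
    MultilinearMap ℂ (fun _ : Fin (n + 1) => SeqSpace p) (SeqSpace p) where
  toFun x := seqMk (fun m => ((|((m : ℤ) : ℝ)| ^ s : ℝ) : ℂ) *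
      conv (n + 1) (fun j => seq s (x j)) m)
    ((ellNorm_conv_seq_le hC n x).trans_lt (ENNReal.mul_lt_top ENNReal.ofReal_lt_top
      (ENNReal.prod_lt_top fun _ _ => enorm_lt_top)))
  map_update_add' x i u v := by
    refine lp.ext (funext fun m => ?_)
    rw [lp.coeFn_add, Pi.add_apply]
    simp only [seqMk_apply, conv_seq_eq, MultilinearMap.map_update_add]
    have hs : ∀ y, Summable fun k : Freq (n + 1) m => convSummand s p k.1 y := fun y => by
      simpa only [convSummand_apply] using summable_freq hC n y m.2
    rw [(hs _).tsum_add (hs _)]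
    ring
  map_update_smul' x i c u := by
    refine lp.ext (funext fun m => ?_)
    rw [lp.coeFn_smul, Pi.smul_apply]
    simp only [seqMk_apply, conv_seq_eq, MultilinearMap.map_update_smul, smul_eq_mul,
      tsum_mul_left]
    ring

theorem norm_convMultilinear_le (hC : FLBounds s p C) (n : ℕ) (x : Fin (n + 1) → SeqSpace p) :
    ‖convMultilinear hC n x‖ ≤ ((n + 1 : ℕ) : ℝ) ^ (2 + s) * C ^ n * ∏ j, ‖x j‖ := by
  have hC0 := hC.C_nonneg
  refine (ENNReal.ofReal_le_ofReal_iff (by positivity)).1 ?_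
  rw [ofReal_norm, ENNReal.ofReal_mul (by positivity),
    ENNReal.ofReal_prod_of_nonneg fun _ _ => norm_nonneg _, enorm_eq_ellNorm]
  simp only [ofReal_norm]
  exact ellNorm_conv_seq_le hC n x

/-- The power series `∑_{n ≥ 2} 𝒩ⁿ(0)` on `ℓ^p(ℤ₀)`. -/
def normalSeries (hC : FLBounds s p C) : FormalMultilinearSeries ℂ (SeqSpace p) (SeqSpace p)
  | 0 => 0
  | 1 => 0
  | n + 2 => (convMultilinear hC (n + 1)).mkContinuous _ (norm_convMultilinear_le hC (n + 1))

theorem seq_normalSeries (hC : FLBounds s p C) (n : ℕ) (x : SeqSpace p) :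
    seq s (normalSeries hC (n + 2) fun _ => x) = conv (n + 2) fun _ => seq s x := by
  ext m
  by_cases hm : m = 0
  · rw [hm, seq_zero_freq]
    simp [conv, coefN]
  · have := one_le_abs_znonzero ⟨m, hm⟩
    simp only at this
    rw [seq_apply s _ ⟨m, hm⟩]
    change _ * (((|(m : ℝ)| ^ s : ℝ) : ℂ) * conv (n + 2) (fun _ => seq s x) m) = _
    rw [← mul_assoc, ← Complex.ofReal_mul, ← Real.rpow_add (by linarith)]
    simp

theorem normalSeries_radius_pos (hC : FLBounds s p C) : 0 < (normalSeries hC).radius := by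
  have hC0 := hC.C_nonneg
  -- Chosen so that C r ≤ 1/2, leaving a polynomial times a geometric series.
  set r : NNReal := ⟨1 / (2 * (C + 1)), by positivity⟩ with hr
  have hr0 : 0 < r := by
    rw [← NNReal.coe_pos]; change 0 < 1 / (2 * (C + 1)); positivity
  have hr1 : (r : ℝ) ≤ 1 := by
    change 1 / (2 * (C + 1)) ≤ 1
    rw [div_le_one (by positivity)]; linarith
  have hCr : C * r ≤ 1 / 2 := by
    change C * (1 / (2 * (C + 1))) ≤ 1 / 2
    rw [mul_one_div, div_le_div_iff₀ (by positivity) (by norm_num)]; linarith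
  refine lt_of_lt_of_le (ENNReal.coe_pos.2 hr0)
    ((normalSeries hC).le_radius_of_summable ((summable_nat_add_iff 2).1 ?_))
  refine Summable.of_nonneg_of_le (fun n => by positivity) (fun n => ?_)
    (summable_rpow_mul_geometric (2 + s))
  have h1 : ‖normalSeries hC (n + 2)‖ ≤ ((n + 2 : ℕ) : ℝ) ^ (2 + s) * C ^ (n + 1) :=
    MultilinearMap.mkContinuous_norm_le _ (by positivity) (norm_convMultilinear_le hC (n + 1))
  calc ‖normalSeries hC (n + 2)‖ * (r : ℝ) ^ (n + 2)
      ≤ (((n + 2 : ℕ) : ℝ) ^ (2 + s) * C ^ (n + 1)) * (r : ℝ) ^ (n + 2) := by gcongr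
    _ = ((n + 2 : ℕ) : ℝ) ^ (2 + s) * ((C * r) ^ (n + 1) * r) := by ring
    _ ≤ ((n + 2 : ℕ) : ℝ) ^ (2 + s) * ((1 / 2) ^ (n + 1) * 1) := by gcongr
    _ ≤ _ := by
      gcongr
      rw [pow_succ, mul_one]
      exact mul_le_of_le_one_right (by positivity) (by norm_num)

/-- The nonlinearity `∑_{n ≥ 2} 𝒩ⁿ(0)` on `ℓ^p(ℤ₀)`. -/
def normalG (hC : FLBounds s p C) (x : SeqSpace p) : SeqSpace p := (normalSeries hC).sum x

theorem hasFPowerSeriesAt_normalG (hC : FLBounds s p C) :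
    HasFPowerSeriesAt (normalG hC) (normalSeries hC) 0 :=
  ⟨_, (normalSeries hC).hasFPowerSeriesOnBall (normalSeries_radius_pos hC)⟩

theorem normalG_zero (hC : FLBounds s p C) : normalG hC 0 = 0 :=
  (hasFPowerSeriesAt_normalG hC).coeff_zero (fun _ => 0) ▸ rfl

/-- The derivative is the degree-one coefficient, which vanishes as the series starts at n = 2. -/
theorem hasStrictFDerivAt_normalG (hC : FLBounds s p C) :
    HasStrictFDerivAt (𝕜 := ℂ) (normalG hC) 0 0 := by
  have h := (hasFPowerSeriesAt_normalG hC).hasStrictFDerivAt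
  have e : normalSeries hC 1 = 0 := rfl
  rw [e, map_zero] at h
  exact h

theorem exists_hasSum_normalG (hC : FLBounds s p C) : ∃ ρ > 0, ∀ x : SeqSpace p, ‖x‖ ≤ ρ →
    HasSum (fun n => normalSeries hC (n + 2) fun _ => x) (normalG hC x) := by
  obtain ⟨r, hr⟩ := hasFPowerSeriesAt_normalG hC
  obtain ⟨ρ, hρ, hρr⟩ := ENNReal.lt_iff_exists_nnreal_btwn.1 hr.r_pos
  refine ⟨ρ, by exact_mod_cast hρ, fun x hx => ?_⟩
  have h := hr.hasSum (y := x) (by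
    rw [Metric.mem_eball, edist_zero_right]
    refine lt_of_le_of_lt ?_ hρr
    rw [← ofReal_norm]
    exact ENNReal.ofReal_le_of_le_toReal (by simpa using hx))
  rw [zero_add] at h
  have := (hasSum_nat_add_iff' 2).2 h
  simpa [Finset.sum_range_succ, normalSeries] using this

end Estimates

theorem termN_zero_time (n : ℕ) (a : ℤ → ℂ) : termN n 0 a = conv n fun _ => a := by
  ext m
  simp [termN, conv, coefN, summandN]

theorem exists_tsum_rpow_mul_pow_le (b : ℝ) {C ε : ℝ} (hC : 0 ≤ C) (hε : 0 < ε) :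
    ∃ ρ : ℝ, 0 < ρ ∧ ∀ r : ℝ≥0∞, r ≤ ENNReal.ofReal ρ →
      ∑' n : ℕ, ENNReal.ofReal (((n + 2 : ℕ) : ℝ) ^ b) * (ENNReal.ofReal C * r) ^ (n + 1)
        ≤ ENNReal.ofReal ε := by
  have hsum := summable_rpow_mul_geometric b
  set S := ∑' n : ℕ, ((n + 2 : ℕ) : ℝ) ^ b * (1 / 2 : ℝ) ^ n with hS
  have hS0 : 0 ≤ S := tsum_nonneg fun n => by positivity
  -- Of the n + 1 factors η, n are bounded by 1/2 for convergence and the last one by ε / (S + 1)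
  -- for smallness.
  set η := min (1 / 2) (ε / (S + 1)) with hη
  have hη0 : 0 < η := by positivity
  refine ⟨η / (C + 1), by positivity, fun r hr => ?_⟩
  have hCr : ENNReal.ofReal C * r ≤ ENNReal.ofReal η := by
    refine (mul_le_mul' le_rfl hr).trans ?_
    rw [← ENNReal.ofReal_mul hC]
    refine ENNReal.ofReal_le_ofReal ?_
    rw [mul_div_assoc', div_le_iff₀ (by positivity)]
    nlinarith
  have hterm : ∀ n : ℕ,
      ENNReal.ofReal (((n + 2 : ℕ) : ℝ) ^ b) * (ENNReal.ofReal C * r) ^ (n + 1)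
      ≤ ENNReal.ofReal (((n + 2 : ℕ) : ℝ) ^ b * (1 / 2 : ℝ) ^ n * (ε / (S + 1))) := by
    intro n
    rw [mul_assoc, ENNReal.ofReal_mul (by positivity)]
    gcongr
    refine (pow_le_pow_left' hCr _).trans ?_
    rw [← ENNReal.ofReal_pow hη0.le]
    refine ENNReal.ofReal_le_ofReal ?_
    rw [pow_succ]
    gcongr
    · exact min_le_left _ _
    · exact min_le_right _ _
  refine (ENNReal.tsum_le_tsum hterm).trans ?_
  rw [← ENNReal.ofReal_tsum_of_nonneg (fun n => by positivity) (hsum.mul_right _), tsum_mul_right]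
  refine ENNReal.ofReal_le_ofReal ?_
  rw [← hS, mul_div_assoc', div_le_iff₀ (by positivity)]
  nlinarith

/-- Reflection `m ↦ -m` of the nonzero frequencies. -/
def negEquiv : ZNonzero ≃ ZNonzero := (Equiv.neg ℤ).subtypeEquiv fun k => by simp

section Nonlinearities

variable {s p C : ℝ} [Fact (1 ≤ p)]

/-- The radius may depend on σ, through the power of n, but must not depend on `N`, which later
tends to infinity. -/
theorem exists_tsum_truncNorm_le (hC : FLBounds s p C) {σ ε : ℝ} (hσ : 0 ≤ σ) (hε : 0 < ε) :
    ∃ ρ : ℝ, 0 < ρ ∧ ∀ a : ℤ → ℂ, flNorm s p a ≤ ENNReal.ofReal ρ → ∀ N : ℝ, 0 ≤ N →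
      ∑' n : ℕ, truncNorm s σ N p (termN (n + 2) 0 a)
        ≤ ENNReal.ofReal ε * truncNorm s σ N p a := by
  obtain ⟨ρ, hρ, h⟩ := exists_tsum_rpow_mul_pow_le (2 + s + σ) hC.C_nonneg hε
  refine ⟨ρ, hρ, fun a ha N hN => ?_⟩
  refine le_trans ?_ (mul_le_mul' (h _ ha) le_rfl)
  rw [← ENNReal.tsum_mul_right]
  refine ENNReal.tsum_le_tsum fun n => ?_
  rw [termN_zero_time]
  exact truncNorm_termN_le hC hσ hN (n + 1) a

/-! ### The quadratic form `M` -/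

theorem tsum_enorm_mass_le (hC : FLBounds s p C) (x y : SeqSpace p) :
    ∑' m : ZNonzero, ‖seq s x m * seq s y (-m)‖ₑ ≤ ENNReal.ofReal (C ^ 2) * (‖x‖ₑ * ‖y‖ₑ) := by
  have h := tsum_mul_le_ellNorm (p := 2) (q := 2) (Real.HolderConjugate.two_two)
    (fun m : ZNonzero => ‖seq s x m‖ₑ) (fun m : ZNonzero => ‖seq s y (-m)‖ₑ)
  have e : ellNorm 2 (fun m : ZNonzero => ‖seq s y (-m)‖ₑ)
      = ellNorm 2 (fun m : ZNonzero => ‖seq s y m‖ₑ) := by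
    rw [ellNorm, ellNorm, ← negEquiv.tsum_eq (fun m : ZNonzero => ‖seq s y m‖ₑ ^ (2 : ℝ))]
    rfl
  rw [e] at h
  simp only [enorm_mul]
  refine h.trans ((mul_le_mul' (hC.two_le _) (hC.two_le _)).trans_eq ?_)
  rw [flNorm_seq, flNorm_seq, ENNReal.ofReal_pow hC.C_nonneg]
  ring

theorem summable_mass (hC : FLBounds s p C) (x y : SeqSpace p) :
    Summable fun m : ZNonzero => seq s x m * seq s y (-m) :=
  Summable.of_enorm ((tsum_enorm_mass_le hC x y).trans_lt
    (ENNReal.mul_lt_top ENNReal.ofReal_lt_top (ENNReal.mul_lt_top enorm_lt_top enorm_lt_top))).ne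

/-- The bilinear form `∑_m f_m g_{-m}`. -/
def massForm (hC : FLBounds s p C) : SeqSpace p →L[ℂ] SeqSpace p →L[ℂ] ℂ :=
  LinearMap.mkContinuous₂
    (LinearMap.mk₂ ℂ (fun x y => ∑' m : ZNonzero, seq s x m * seq s y (-m))
      (fun x x' y => by
        simp only [map_add, Pi.add_apply, add_mul]
        exact (summable_mass hC x y).tsum_add (summable_mass hC x' y))
      (fun c x y => by
        simp only [map_smul, Pi.smul_apply, smul_eq_mul, mul_assoc, tsum_mul_left])
      (fun x y y' => by
        simp only [map_add, Pi.add_apply, mul_add]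
        exact (summable_mass hC x y).tsum_add (summable_mass hC x y'))
      (fun c x y => by
        simp only [map_smul, Pi.smul_apply, smul_eq_mul, mul_left_comm _ c, tsum_mul_left]))
    (C ^ 2) fun x y => by
      refine (ENNReal.ofReal_le_ofReal_iff (by positivity)).1 ?_
      rw [ofReal_norm, mul_assoc, ENNReal.ofReal_mul (by positivity),
        ENNReal.ofReal_mul (by positivity), ofReal_norm, ofReal_norm]
      exact enorm_tsum_le_tsum_enorm.trans (tsum_enorm_mass_le hC x y)

theorem massForm_apply (hC : FLBounds s p C) (x y : SeqSpace p) :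
    massForm hC x y = ∑' m : ZNonzero, seq s x m * seq s y (-m) := rfl

theorem norm_massForm_le (hC : FLBounds s p C) (x y : SeqSpace p) :
    ‖massForm hC x y‖ ≤ C ^ 2 * (‖x‖ * ‖y‖) := by
  refine (ENNReal.ofReal_le_ofReal_iff (by positivity)).1 ?_
  rw [ofReal_norm, ENNReal.ofReal_mul (by positivity),
    ENNReal.ofReal_mul (by positivity), ofReal_norm, ofReal_norm]
  exact enorm_tsum_le_tsum_enorm.trans (tsum_enorm_mass_le hC x y)

theorem massM_seq (hC : FLBounds s p C) (x : SeqSpace p) :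
    massM 0 (seq s x) = massForm hC x x := by
  simp [massM, summandM, massForm_apply]

/-- The nonlinearity `∑_{n ≥ 2} ℛⁿ(0)` on `ℓ^p(ℤ₀)`. -/
def normalH (hC : FLBounds s p C) (x : SeqSpace p) : SeqSpace p :=
  (-(Complex.I / 4) * massForm hC x x) • (normalG hC x - x)

theorem normalH_zero (hC : FLBounds s p C) : normalH hC 0 = 0 := by simp [normalH]

/-- Product rule: M and G - id both vanish at 0. -/
theorem hasStrictFDerivAt_normalH (hC : FLBounds s p C) :
    HasStrictFDerivAt (𝕜 := ℂ) (normalH hC) 0 0 := by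
  have h1 : HasStrictFDerivAt (𝕜 := ℂ) (fun x => massForm hC x x) _ 0 :=
    (massForm hC).hasStrictFDerivAt.clm_apply (hasStrictFDerivAt_id 0)
  have h2 := (h1.const_mul (-(Complex.I / 4))).smul
    ((hasStrictFDerivAt_normalG hC).sub (hasStrictFDerivAt_id 0))
  refine h2.congr_fderiv ?_
  ext1 x
  simp [normalG_zero]

theorem exists_lipschitzOnWith_closedBall {f : SeqSpace p → SeqSpace p}
    (hf : HasStrictFDerivAt (𝕜 := ℂ) f 0 0) :
    ∃ ρ : ℝ, 0 < ρ ∧ LipschitzOnWith (1 / 8) f (Metric.closedBall 0 ρ) := by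
  obtain ⟨u, hu, hlip⟩ := hf.exists_lipschitzOnWith_of_nnnorm_lt (1 / 8) (by simp)
  obtain ⟨ρ, hρ, hsub⟩ := Metric.nhds_basis_closedBall.mem_iff.1 hu
  exact ⟨ρ, hρ, hlip.mono hsub⟩

/-! ### Coefficients of the nonlinearities -/

/-- The coefficient functional `x ↦ |m|^{-s} x_m`. -/
def seqCLM (s : ℝ) (m : ZNonzero) : SeqSpace p →L[ℂ] ℂ :=
  ((|((m : ℤ) : ℝ)| ^ (-s) : ℝ) : ℂ) • lp.evalCLM ℂ (fun _ : ZNonzero => ℂ) (ENNReal.ofReal p) m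

theorem seqCLM_apply (s : ℝ) (m : ZNonzero) (x : SeqSpace p) : seqCLM s m x = seq s x m := by
  rw [seq_apply]; rfl

theorem hasSum_termN_zero {hC : FLBounds s p C} {x : SeqSpace p}
    (hx : HasSum (fun n => normalSeries hC (n + 2) fun _ => x) (normalG hC x)) (m : ZNonzero) :
    HasSum (fun n => termN (n + 2) 0 (seq s x) m) (seq s (normalG hC x) m) := by
  have h := hx.mapL (seqCLM s m)
  simpa only [seqCLM_apply, seq_normalSeries, ← termN_zero_time] using h

end Nonlinearities

/-! ### The first term, and reduction from time `t` to time 0 by the propagator -/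

theorem termN_one_zero (a : ℤ → ℂ) {m : ℤ} (hm : m ≠ 0) : termN 1 0 a m = -a m := by
  have h : ∑' k : Freq 1 m, summandN 0 a k.1 = a m / m := by
    rw [tsum_eq_single (⟨fun _ => m, fun _ => hm, by simp⟩ : Freq 1 m)]
    · simp [summandN]
    · rintro ⟨k, hk, hk'⟩ hne
      refine absurd (Subtype.ext (funext fun j => ?_)) hne
      rw [Fin.sum_univ_one] at hk'
      rw [Subsingleton.elim j 0]
      exact hk'
  have hm' : (m : ℂ) ≠ 0 := by exact_mod_cast hm
  rw [termN, h]
  simp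
  field_simp

/-- e^{iΦ_n t} factors into the phase of the total frequency at time -t and those of the k_j at time
t. -/
theorem summandN_eq {n : ℕ} (t : ℝ) (a : ℤ → ℂ) (k : Fin n → ℤ) :
    summandN t a k = phase (-t) (∑ j, k j) * summandN 0 (fun l => phase t l * a l) k := by
  have h : Complex.exp (Complex.I * (modulation k : ℂ) * (t : ℂ))
      = phase (-t) (∑ j, k j) * ∏ j, phase t (k j) := by
    simp only [phase, ← Complex.exp_sum, ← Complex.exp_add, modulation]
    congr 1
    push_cast
    rw [← Finset.sum_mul, ← Finset.mul_sum]
    ring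
  simp only [summandN, h, mul_div_assoc, Finset.prod_mul_distrib]
  simp
  ring

theorem termN_eq (n : ℕ) (t : ℝ) (a : ℤ → ℂ) (m : ℤ) :
    termN n t a m = phase (-t) m * termN n 0 (fun l => phase t l * a l) m := by
  have : ∀ k : Freq n m, summandN t a k.1
      = phase (-t) m * summandN 0 (fun l => phase t l * a l) k.1 := fun k => by
    rw [summandN_eq, k.2.2]
  simp only [termN, this, tsum_mul_left]
  ring

/-- The frequencies m and -m contribute equal phases, as m² + (-m)² = 2m². -/
theorem summandM_eq (t : ℝ) (a : ℤ → ℂ) (m : ℤ) :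
    summandM t a m = summandM 0 (fun l => phase t l * a l) m := by
  have h : Complex.exp (-2 * Complex.I * (m : ℂ) ^ 2 * (t : ℂ)) = phase t m * phase t (-m) := by
    rw [phase, phase, ← Complex.exp_add]
    congr 1
    push_cast
    ring
  simp only [summandM, h]
  simp
  ring

theorem massM_eq (t : ℝ) (a : ℤ → ℂ) : massM t a = massM 0 (fun l => phase t l * a l) := by
  simp only [massM, summandM_eq t a]

theorem termR_eq (n : ℕ) (t : ℝ) (a : ℤ → ℂ) (m : ℤ) :
    termR n t a m = phase (-t) m * termR n 0 (fun l => phase t l * a l) m := by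
  rw [termR, termR, termN_eq, massM_eq]
  ring

theorem flNorm_phase_mul (s p t : ℝ) (a : ℤ → ℂ) :
    flNorm s p (fun l => phase t l * a l) = flNorm s p a := by
  simp only [flNorm, enorm_mul, enorm_phase, one_mul]

theorem flNorm_termN_one (s p t : ℝ) (a : ℤ → ℂ) : flNorm s p (termN 1 t a) = flNorm s p a := by
  rw [flNorm, flNorm]
  congr 1
  refine tsum_congr fun k => ?_
  rw [termN_eq, termN_one_zero _ k.2, enorm_mul, enorm_phase, enorm_neg, enorm_mul, enorm_phase,
    one_mul, one_mul]

section TimeDependent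

variable {s p C : ℝ} [Fact (1 ≤ p)]

theorem hasSum_termR_zero {hC : FLBounds s p C} {x : SeqSpace p}
    (hx : HasSum (fun n => normalSeries hC (n + 2) fun _ => x) (normalG hC x)) (m : ZNonzero) :
    HasSum (fun n => termR (n + 2) 0 (seq s x) m) (seq s (normalH hC x) m) := by
  -- ℛⁿ involves 𝒩^{n-1}, so the sum starts at 𝒩¹ = -id; hence the -x in `normalH`.
  have h1 : HasSum (fun n => termN (n + 1) 0 (seq s x) m) (seq s (normalG hC x - x) m) := by
    rw [← hasSum_nat_add_iff' 1]
    simpa [termN_one_zero _ m.2] using hasSum_termN_zero hx m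
  have h2 := h1.mul_left (-(Complex.I / 4) * massForm hC x x)
  rw [normalH, map_smul, Pi.smul_apply, smul_eq_mul]
  simp only [termR, massM_seq hC]
  exact h2

theorem seq_interaction (G : SeqSpace p → SeqSpace p) (t : ℝ) (x : SeqSpace p) (m : ℤ) :
    seq s (interaction G t x) m = phase (-t) m * seq s (G (propagator t x)) m := by
  rw [interaction, seq_propagator]

/-- Absolute convergence of the series for `∑_{n ≥ 2} 𝒩ⁿ(0)` on the ball of radius `ρ`, together
with the smallness of both nonlinearities in all truncated norms. -/
structure IsConvRadius (hC : FLBounds s p C) (σ ρ : ℝ) : Prop where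
  pos : 0 < ρ
  hasSum : ∀ x : SeqSpace p, ‖x‖ ≤ ρ →
    HasSum (fun n => normalSeries hC (n + 2) fun _ => x) (normalG hC x)
  tsum_le : ∀ a : ℤ → ℂ, flNorm s p a ≤ ENNReal.ofReal ρ → ∀ N : ℝ, 0 ≤ N →
      ∑' n : ℕ, truncNorm s σ N p (termN (n + 2) 0 a)
        ≤ ENNReal.ofReal (1 / 8) * truncNorm s σ N p a
  mass_le : C ^ 2 * ρ ^ 2 ≤ 1 / 4

theorem exists_isConvRadius (hC : FLBounds s p C) {σ : ℝ} (hσ : 0 ≤ σ) :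
    ∃ ρ, IsConvRadius hC σ ρ := by
  obtain ⟨ρ₁, h1, h1'⟩ := exists_hasSum_normalG hC
  obtain ⟨ρ₂, h2, h2'⟩ := exists_tsum_truncNorm_le hC hσ (show (0 : ℝ) < 1 / 8 by norm_num)
  have hC0 := hC.C_nonneg
  -- Gives Cρ ≤ 1/2, hence |M| ≤ 1/4 on the ball.
  set ρ₃ := 1 / (2 * (C + 1)) with h3
  have hρ : 0 < min (min ρ₁ ρ₂) ρ₃ := by positivity
  refine ⟨min (min ρ₁ ρ₂) ρ₃, hρ, fun x hx => h1' x (hx.trans ?_),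
    fun a ha => h2' a (ha.trans (ENNReal.ofReal_le_ofReal ?_)), ?_⟩
  · exact (min_le_left _ _).trans (min_le_left _ _)
  · exact (min_le_left _ _).trans (min_le_right _ _)
  · have h : C * min (min ρ₁ ρ₂) ρ₃ ≤ 1 / 2 := by
      calc C * min (min ρ₁ ρ₂) ρ₃ ≤ C * ρ₃ := by gcongr; exact min_le_right _ _
        _ ≤ 1 / 2 := by
          rw [h3, mul_one_div, div_le_div_iff₀ (by positivity) (by norm_num)]; linarith
    rw [← mul_pow]
    calc (C * min (min ρ₁ ρ₂) ρ₃) ^ 2 ≤ (1 / 2) ^ 2 := by gcongr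
      _ = 1 / 4 := by norm_num

theorem IsConvRadius.mono {hC : FLBounds s p C} {σ ρ ρ' : ℝ} (h : IsConvRadius hC σ ρ)
    (h0 : 0 < ρ') (hle : ρ' ≤ ρ) : IsConvRadius hC σ ρ' :=
  ⟨h0, fun x hx => h.hasSum x (hx.trans hle),
    fun a ha => h.tsum_le a (ha.trans (ENNReal.ofReal_le_ofReal hle)),
    le_trans (by gcongr) h.mass_le⟩

theorem enorm_le_ofReal {x : SeqSpace p} {ρ : ℝ} (hx : ‖x‖ ≤ ρ) : ‖x‖ₑ ≤ ENNReal.ofReal ρ := by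
  rw [← ofReal_norm]
  exact ENNReal.ofReal_le_ofReal hx

section Ball

variable {hC : FLBounds s p C} {σ ρ : ℝ} {x : SeqSpace p}

theorem hasSum_termN (hρ : IsConvRadius hC σ ρ) (hx : ‖x‖ ≤ ρ) (t : ℝ) (m : ZNonzero) :
    HasSum (fun n => termN (n + 2) t (seq s x) m) (seq s (interaction (normalG hC) t x) m) := by
  have h := hasSum_termN_zero (hρ.hasSum (propagator t x) (by rwa [norm_propagator])) m
  simp only [termN_eq _ t, seq_interaction]
  rw [seq_propagator] at h
  exact h.mul_left _

theorem hasSum_termR (hρ : IsConvRadius hC σ ρ) (hx : ‖x‖ ≤ ρ) (t : ℝ) (m : ZNonzero) :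
    HasSum (fun n => termR (n + 2) t (seq s x) m) (seq s (interaction (normalH hC) t x) m) := by
  have h := hasSum_termR_zero (hρ.hasSum (propagator t x) (by rwa [norm_propagator])) m
  simp only [termR_eq _ t, seq_interaction]
  rw [seq_propagator] at h
  exact h.mul_left _

theorem tsum_flNorm_termN_le (hρ : IsConvRadius hC 0 ρ) (hx : ‖x‖ ≤ ρ) (t : ℝ) :
    ∑' n : ℕ, flNorm s p (termN (n + 2) t (seq s x)) ≤ ‖x‖ₑ := by
  have h := hρ.tsum_le (seq s (propagator t x)) (by
    rw [flNorm_seq]; exact enorm_le_ofReal (by rwa [norm_propagator])) 0 le_rfl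
  simp only [truncNorm_zero, seq_propagator, flNorm_phase_mul, flNorm_seq] at h
  have e : ∀ n, termN (n + 2) t (seq s x)
      = fun m => phase (-t) m * termN (n + 2) 0 (fun l => phase t l * seq s x l) m := fun n => by
    ext m; exact termN_eq _ _ _ _
  simp only [e, flNorm_phase_mul]
  refine h.trans (mul_le_of_le_one_left' ?_)
  rw [ENNReal.ofReal_le_one]; norm_num

theorem norm_massM_le (hC : FLBounds s p C) (t : ℝ) (x : SeqSpace p) :
    ‖massM t (seq s x)‖ ≤ C ^ 2 * ‖x‖ ^ 2 := by
  have h := norm_massForm_le hC (propagator t x) (propagator t x)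
  rw [massM_eq, ← seq_propagator, massM_seq hC]
  rwa [norm_propagator, ← sq] at h

theorem tsum_flNorm_termR_le (hρ : IsConvRadius hC 0 ρ) (hx : ‖x‖ ≤ ρ) (t : ℝ) :
    ∑' n : ℕ, flNorm s p (termR (n + 2) t (seq s x)) ≤ 2 * ENNReal.ofReal ρ := by
  have hc : ‖-(Complex.I / 4) * massM t (seq s x)‖ₑ ≤ 1 := by
    rw [← ofReal_norm, ENNReal.ofReal_le_one, norm_mul, norm_neg, norm_div, Complex.norm_I,
      Complex.norm_ofNat]
    have h1 := norm_massM_le hC t x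
    have h2 : C ^ 2 * ‖x‖ ^ 2 ≤ C ^ 2 * ρ ^ 2 := by gcongr
    have h3 := hρ.mass_le
    linarith
  have e : ∀ n, flNorm s p (termR (n + 2) t (seq s x))
      ≤ flNorm s p (termN (n + 1) t (seq s x)) := fun n => by
    rw [flNorm_eq_ellNorm, flNorm_eq_ellNorm]
    refine ellNorm_mono exponent_pos.le fun k => ?_
    gcongr
    rw [termR, enorm_mul]
    exact mul_le_of_le_one_left' hc
  refine (ENNReal.tsum_le_tsum e).trans ?_
  -- One ρ comes from 𝒩¹, the other from the terms with n ≥ 2.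
  rw [tsum_eq_zero_add' ENNReal.summable, zero_add, flNorm_termN_one, flNorm_seq, two_mul]
  exact add_le_add (enorm_le_ofReal hx) ((tsum_flNorm_termN_le hρ hx t).trans (enorm_le_ofReal hx))

theorem seriesConverge_seq (hρ : IsConvRadius hC 0 ρ) (hx : ‖x‖ ≤ ρ) (t : ℝ) :
    SeriesConverge s p t (seq s x) where
  summable_summandN n hn m hm := by
    obtain ⟨n, rfl⟩ := Nat.exists_eq_add_of_le' hn
    have h := summable_freq hC n (fun _ => propagator t x) hm
    simp only [seq_propagator] at h
    refine (h.mul_left (phase (-t) m)).congr fun k => ?_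
    rw [summandN_eq, k.2.2]
    simp [summandN]
  summable_summandM := by
    have h := summable_mass hC (propagator t x) (propagator t x)
    simp only [seq_propagator] at h
    refine h.congr fun m => ?_
    rw [summandM_eq]
    simp [summandM]
  series_termN := (tsum_flNorm_termN_le hρ hx t).trans_lt enorm_lt_top
  series_termR := (tsum_flNorm_termR_le hρ hx t).trans_lt
    (ENNReal.mul_lt_top (by simp) ENNReal.ofReal_lt_top)

end Ball

/-! ### Truncated regularity -/

/-- Multiplication by `min(|k|, N)^σ`. -/
def truncOp (σ N : ℝ) (hσ : 0 ≤ σ) (hN : 0 ≤ N) : SeqSpace p →L[ℂ] SeqSpace p :=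
  diag (fun k => ((min |((k : ℤ) : ℝ)| N ^ σ : ℝ) : ℂ)) (N ^ σ) fun k => by
    have h0 : 0 ≤ min |((k : ℤ) : ℝ)| N := le_min (abs_nonneg _) hN
    rw [Complex.norm_real, Real.norm_of_nonneg (by positivity)]
    exact Real.rpow_le_rpow h0 (min_le_right _ _) hσ

theorem enorm_truncOp (s : ℝ) {σ N : ℝ} (hσ : 0 ≤ σ) (hN : 0 ≤ N) (x : SeqSpace p) :
    ‖truncOp σ N hσ hN x‖ₑ = truncNorm s σ N p (seq s x) := by
  rw [truncOp, enorm_diag, truncNorm]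
  congr 1
  ext k
  have h0 : 0 ≤ min |((k : ℤ) : ℝ)| N := le_min (abs_nonneg _) hN
  rw [apply_eq_seq s x k, enorm_rpow_mul, truncWeight, ENNReal.ofReal_mul (by positivity),
    ← ofReal_norm (((min |((k : ℤ) : ℝ)| N ^ σ : ℝ) : ℂ)), Complex.norm_real,
    Real.norm_of_nonneg (by positivity)]
  ring

theorem norm_truncOp_propagator {σ N : ℝ} (hσ : 0 ≤ σ) (hN : 0 ≤ N) (t : ℝ) (x : SeqSpace p) :
    ‖truncOp σ N hσ hN (propagator t x)‖ = ‖truncOp σ N hσ hN x‖ := by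
  have h : ‖truncOp σ N hσ hN (propagator t x)‖ₑ = ‖truncOp σ N hσ hN x‖ₑ := by
    simp only [truncOp, enorm_diag, propagator_apply, enorm_mul, enorm_phase, one_mul]
  simpa [← ofReal_norm] using h

/-- The truncated multiplier is bounded, so it may be applied to the power series term by term. -/
theorem norm_truncOp_normalG_le {hC : FLBounds s p C} {σ ρ N : ℝ} (hρ : IsConvRadius hC σ ρ)
    (hσ : 0 ≤ σ) (hN : 0 ≤ N) {x : SeqSpace p} (hx : ‖x‖ ≤ ρ) :
    ‖truncOp σ N hσ hN (normalG hC x)‖ ≤ 1 / 8 * ‖truncOp σ N hσ hN x‖ := by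
  refine (ENNReal.ofReal_le_ofReal_iff (by positivity)).1 ?_
  rw [ENNReal.ofReal_mul (by norm_num), ofReal_norm, ofReal_norm]
  have h := hρ.tsum_le _ (by rw [flNorm_seq]; exact enorm_le_ofReal hx) N hN
  rw [← enorm_truncOp s hσ hN] at h
  refine le_trans ?_ h
  rw [← ((hρ.hasSum x hx).mapL (truncOp σ N hσ hN)).tsum_eq]
  refine enorm_tsum_le_tsum_enorm.trans_eq (tsum_congr fun n => ?_)
  rw [enorm_truncOp s, seq_normalSeries, termN_zero_time]

theorem norm_truncOp_normalH_le {hC : FLBounds s p C} {σ ρ N : ℝ} (hρ : IsConvRadius hC σ ρ)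
    (hσ : 0 ≤ σ) (hN : 0 ≤ N) {x : SeqSpace p} (hx : ‖x‖ ≤ ρ) :
    ‖truncOp σ N hσ hN (normalH hC x)‖ ≤ 1 / 8 * ‖truncOp σ N hσ hN x‖ := by
  rw [normalH, map_smul, map_sub, norm_smul, norm_mul, norm_neg, norm_div, Complex.norm_I,
    Complex.norm_ofNat]
  have h1 := norm_massForm_le hC x x
  have h2 : C ^ 2 * (‖x‖ * ‖x‖) ≤ C ^ 2 * ρ ^ 2 := by rw [← sq]; gcongr
  have h3 := hρ.mass_le
  have h4 := norm_truncOp_normalG_le hρ hσ hN hx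
  have h5 := norm_sub_le (truncOp σ N hσ hN (normalG hC x)) (truncOp σ N hσ hN x)
  have h6 : 1 / 4 * ‖massForm hC x x‖ ≤ 1 / 16 := by linarith
  have h7 : ‖truncOp σ N hσ hN (normalG hC x) - truncOp σ N hσ hN x‖
      ≤ 2 * ‖truncOp σ N hσ hN x‖ := by
    have := norm_nonneg (truncOp σ N hσ hN x)
    linarith
  -- |M|/4 ≤ 1/16, and G - id at most doubles the weighted norm; the product is 1/8.
  calc _ ≤ 1 / 16 * (2 * ‖truncOp σ N hσ hN x‖) := by gcongr
    _ = _ := by ring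

theorem norm_truncOp_interaction_le {G : SeqSpace p → SeqSpace p} {σ ρ N : ℝ} (hσ : 0 ≤ σ)
    (hN : 0 ≤ N)
    (hG : ∀ x, ‖x‖ ≤ ρ → ‖truncOp σ N hσ hN (G x)‖ ≤ 1 / 8 * ‖truncOp σ N hσ hN x‖)
    (t : ℝ) (x : SeqSpace p) (hx : ‖x‖ ≤ ρ) :
    ‖truncOp σ N hσ hN (interaction G t x)‖ ≤ 1 / 8 * ‖truncOp σ N hσ hN x‖ := by
  rw [interaction, norm_truncOp_propagator, ← norm_truncOp_propagator hσ hN t x]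
  exact hG _ (by rwa [norm_propagator])

/-- Bounds in all truncated norms give a bound in the norm with higher regularity. -/
theorem flNorm_add_le_of_truncOp {σ : ℝ} (hσ : 0 ≤ σ) {x : SeqSpace p} {B : ℝ≥0∞}
    (h : ∀ N (hN : 0 ≤ N), ‖truncOp σ N hσ hN x‖ₑ ≤ B) : flNorm (s + σ) p (seq s x) ≤ B := by
  rw [flNorm_eq_ellNorm, ellNorm_le_iff exponent_pos]
  intro u
  -- Any `N` dominating |k| on the finite set `u` would do: the truncation is then inactive there.
  set N : ℝ := ∑ k ∈ u, |((k : ℤ) : ℝ)|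
  have hN : 0 ≤ N := Finset.sum_nonneg fun k _ => abs_nonneg _
  refine le_trans ?_ (ENNReal.rpow_le_rpow (h N hN) exponent_pos.le)
  rw [enorm_truncOp s]
  refine le_trans (Finset.sum_le_sum fun k hk => ?_)
    (sum_rpow_le_ellNorm_rpow exponent_pos _ u)
  have hkN : |((k : ℤ) : ℝ)| ≤ N :=
    Finset.single_le_sum (f := fun k : ZNonzero => |((k : ℤ) : ℝ)|) (fun k _ => abs_nonneg _) hk
  have := one_le_abs_znonzero k
  rw [truncWeight, min_eq_left hkN, ← Real.rpow_add (by linarith)]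

theorem enorm_truncOp_le {σ N : ℝ} (hσ : 0 ≤ σ) (hN : 0 ≤ N) (x : SeqSpace p) :
    ‖truncOp σ N hσ hN x‖ₑ ≤ flNorm (s + σ) p (seq s x) := by
  rw [enorm_truncOp s, flNorm_eq_ellNorm]
  refine ellNorm_mono exponent_pos.le fun k => ?_
  have := one_le_abs_znonzero k
  gcongr
  rw [truncWeight, Real.rpow_add (by linarith)]
  gcongr
  exact min_le_left _ _

end TimeDependent

/-! ### Fourier coefficients of `L²` functions -/

theorem coeff_eq_repr (f : L2Torus) (k : ℤ) : coeff f k = fourierBasis.repr f k :=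
  (fourierBasis_repr f k).symm

theorem coeff_sub (f g : L2Torus) : coeff (f - g) = coeff f - coeff g := by
  ext k
  simp only [Pi.sub_apply, coeff_eq_repr, map_sub]
  rfl

theorem coeff_injective : Function.Injective coeff := by
  intro f g h
  refine fourierBasis.repr.injective (lp.ext (funext fun k => ?_))
  rw [← coeff_eq_repr, ← coeff_eq_repr, h]

theorem exists_coeff_eq {a : ℤ → ℂ} (ha : Summable fun k => ‖a k‖ ^ (2 : ℝ)) :
    ∃ f : L2Torus, coeff f = a := by
  have hmem : Memℓp a 2 := memℓp_gen (by simpa using ha)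
  refine ⟨fourierBasis.repr.symm ⟨a, hmem⟩, funext fun k => ?_⟩
  rw [coeff_eq_repr, LinearIsometryEquiv.apply_symm_apply]

/-! ### Passage between solutions in `L²` and paths in `ℓ^p(ℤ₀)` -/

section Solutions

variable {s p C : ℝ} [Fact (1 ≤ p)]

/-- By the embedding into ℓ² and Riesz–Fischer. -/
theorem exists_coeff_eq_seq (hC : FLBounds s p C) (x : SeqSpace p) :
    ∃ f : L2Torus, coeff f = seq s x := by
  refine exists_coeff_eq ?_
  have h2 : Fact ((1 : ℝ) ≤ 2) := ⟨by norm_num⟩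
  have h := (hC.two_le (seq s x)).trans_lt
    (ENNReal.mul_lt_top ENNReal.ofReal_lt_top (by rw [flNorm_seq]; exact enorm_lt_top))
  have h3 := (memℓp_iff_ellNorm_lt_top (p := 2)).2 h
  rw [memℓp_gen_iff (by rw [toReal_exponent]; norm_num), toReal_exponent] at h3
  refine (Function.Injective.summable_iff (g := fun k : ZNonzero => (k : ℤ))
    Subtype.val_injective fun k hk => ?_).1 h3
  have : k = 0 := by
    by_contra hne
    exact hk ⟨⟨k, hne⟩, rfl⟩
  rw [this, seq_zero_freq, norm_zero, Real.zero_rpow (by norm_num)]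

theorem enorm_sub_eq_flNorm {x y : SeqSpace p} {f g : L2Torus} (hx : seq s x = coeff f)
    (hy : seq s y = coeff g) : ‖x - y‖ₑ = flNorm s p (coeff (f - g)) := by
  rw [← flNorm_seq s, map_sub, hx, hy, coeff_sub]

/-- A radius on which both nonlinearities are small, with all series converging absolutely. -/
structure IsGoodRadius (hC : FLBounds s p C) (ρ : ℝ) : Prop where
  conv : IsConvRadius hC 0 ρ
  lipG : IsSmallLipschitz ρ (interaction (normalG hC))
  lipH : IsSmallLipschitz ρ (interaction (normalH hC))

theorem exists_isGoodRadius (hC : FLBounds s p C) : ∃ ρ, IsGoodRadius hC ρ := by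
  obtain ⟨ρ₀, h0⟩ := exists_isConvRadius hC le_rfl
  obtain ⟨ρ₁, h1, hG⟩ := exists_lipschitzOnWith_closedBall (hasStrictFDerivAt_normalG hC)
  obtain ⟨ρ₂, h2, hH⟩ := exists_lipschitzOnWith_closedBall (hasStrictFDerivAt_normalH hC)
  have h00 := h0.pos
  refine ⟨min ρ₀ (min ρ₁ ρ₂), h0.mono (by positivity) (min_le_left _ _),
    isSmallLipschitz_interaction (normalG_zero hC)
      (hG.mono (Metric.closedBall_subset_closedBall ?_)),
    isSmallLipschitz_interaction (normalH_zero hC)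
      (hH.mono (Metric.closedBall_subset_closedBall ?_))⟩
  · exact (min_le_right _ _).trans (min_le_left _ _)
  · exact (min_le_right _ _).trans (min_le_right _ _)

theorem IsSmallLipschitz.mono {E : Type*} [NormedAddCommGroup E] {ρ ρ' : ℝ} {F : ℝ → E → E}
    (hF : IsSmallLipschitz ρ F) (h : ρ' ≤ ρ) : IsSmallLipschitz ρ' F :=
  have hsub := Metric.closedBall_subset_closedBall (x := (0 : E)) h
  ⟨hF.zero, fun t x hx y hy => hF.lipschitz t x (hsub hx) y (hsub hy),
    hF.continuousOn.mono (prod_mono le_rfl hsub)⟩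

variable {hC : FLBounds s p C} {ρ : ℝ}

/-- The integral equation in `ℓ^p(ℤ₀)` is the normal form equation for the coefficients. -/
theorem solvesAt_iff (hρ : IsGoodRadius hC ρ) {φ : SeqSpace p} (hφ : ‖φ‖ ≤ ρ)
    {x : ℝ → SeqSpace p} {t : ℝ} (ht : 0 ≤ t) (hx : ContinuousOn x (Icc 0 t))
    (hxρ : ∀ t' ∈ Icc 0 t, ‖x t'‖ ≤ ρ) :
    SolvesAt (interaction (normalG hC)) (interaction (normalH hC)) φ x t ↔
      ∀ m : ℤ, m ≠ 0 → seq s (x t) m = seq s φ m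
        + ∑' n : ℕ, termN (n + 2) t (seq s (x t)) m
        - ∑' n : ℕ, termN (n + 2) 0 (seq s φ) m
        + ∫ t' in (0 : ℝ)..t, ∑' n : ℕ, termR (n + 2) t' (seq s (x t')) m := by
  have hint := intervalIntegrable_of_continuousOn_Icc ht (hρ.lipH.comp_continuousOn hx hxρ)
  have key : ∀ m : ZNonzero, seq s (φ + interaction (normalG hC) t (x t)
        - interaction (normalG hC) 0 φ
        + ∫ t' in (0 : ℝ)..t, interaction (normalH hC) t' (x t')) m
      = seq s φ m
        + ∑' n : ℕ, termN (n + 2) t (seq s (x t)) m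
        - ∑' n : ℕ, termN (n + 2) 0 (seq s φ) m
        + ∫ t' in (0 : ℝ)..t, ∑' n : ℕ, termR (n + 2) t' (seq s (x t')) m := by
    intro m
    have e : ∫ t' in (0 : ℝ)..t, ∑' n : ℕ, termR (n + 2) t' (seq s (x t')) m
        = seq s (∫ t' in (0 : ℝ)..t, interaction (normalH hC) t' (x t')) m := by
      -- Coefficients are continuous functionals on ℓ^p, so they commute with the vector-valued
      -- integral.
      rw [← seqCLM_apply, ← ContinuousLinearMap.intervalIntegral_comp_comm _ hint]
      refine intervalIntegral.integral_congr fun t' ht' => ?_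
      rw [uIcc_of_le ht] at ht'
      simp only [seqCLM_apply]
      exact (hasSum_termR hρ.conv (hxρ t' ht') t' m).tsum_eq
    rw [e, (hasSum_termN hρ.conv (hxρ t ⟨ht, le_rfl⟩) t m).tsum_eq,
      (hasSum_termN hρ.conv hφ 0 m).tsum_eq]
    simp only [map_add, map_sub, Pi.add_apply, Pi.sub_apply]
  constructor
  · intro h m hm
    rw [← key ⟨m, hm⟩]
    exact congrFun (congrArg (seq s) h) m
  · intro h
    refine seq_injective s (funext fun m => ?_)
    by_cases hm : m = 0
    · rw [hm, seq_zero_freq, seq_zero_freq]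
    · rw [h m hm]
      exact (key ⟨m, hm⟩).symm

/-- No smallness of `v` at positive times is assumed. The coefficient series are identified with G
and H only inside the ball, so the abstract equation is first derived conditionally and the
condition is then removed by `norm_le_of_solvesAt`. -/
theorem exists_path_of_isSolution (hρ : IsGoodRadius hC ρ) {f : L2Torus} {φ : SeqSpace p}
    (hf : seq s φ = coeff f) (hφ : ‖φ‖ ≤ ρ / 2) {v : ℝ → L2Torus} (hv : IsSolution s p 1 f v) :
    ∃ x : ℝ → SeqSpace p, (∀ t ∈ Icc (0 : ℝ) 1, seq s (x t) = coeff (v t)) ∧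
      ContinuousOn x (Icc 0 1) ∧ (∀ t ∈ Icc (0 : ℝ) 1, ‖x t‖ ≤ 3 / 2 * ‖φ‖) ∧
      ∀ t ∈ Icc (0 : ℝ) 1,
        SolvesAt (interaction (normalG hC)) (interaction (normalH hC)) φ x t := by
  have hex : ∀ t, ∃ y : SeqSpace p, t ∈ Icc (0 : ℝ) 1 → seq s y = coeff (v t) := by
    intro t
    by_cases ht : t ∈ Icc (0 : ℝ) 1
    · obtain ⟨y, hy⟩ := exists_seq_eq (hv.continuous.1 t ht).1 (hv.continuous.1 t ht).2
      exact ⟨y, fun _ => hy⟩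
    · exact ⟨0, fun h => absurd h ht⟩
  choose x hx using hex
  have hρ0 := hρ.conv.pos
  have hxc : ContinuousOn x (Icc 0 1) := by
    intro t₀ ht₀
    rw [ContinuousWithinAt, tendsto_iff_edist_tendsto_0]
    refine (hv.continuous.2 t₀ ht₀).congr' ?_
    filter_upwards [self_mem_nhdsWithin] with t ht
    rw [edist_eq_enorm_sub, enorm_sub_eq_flNorm (hx t ht) (hx t₀ ht₀)]
  have hsolve : ∀ t ∈ Icc (0 : ℝ) 1, (∀ t' ∈ Icc 0 t, ‖x t'‖ ≤ ρ) →
      SolvesAt (interaction (normalG hC)) (interaction (normalH hC)) φ x t := by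
    intro t ht hb
    have hsub : Icc 0 t ⊆ Icc 0 1 := Icc_subset_Icc_right ht.2
    refine (solvesAt_iff hρ (by linarith) ht.1 (hxc.mono hsub) hb).2 fun m hm => ?_
    have e : ∫ t' in (0 : ℝ)..t, ∑' n : ℕ, termR (n + 2) t' (seq s (x t')) m
        = ∫ t' in (0 : ℝ)..t, ∑' n : ℕ, termR (n + 2) t' (coeff (v t')) m := by
      refine intervalIntegral.integral_congr fun t' ht' => ?_
      rw [uIcc_of_le ht.1] at ht'
      simp only [hx t' (hsub ht')]
    rw [e, hx t ht, hf]
    exact hv.equation t ht m hm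
  have h0 : x 0 = φ := by
    refine seq_injective s ?_
    rw [hx 0 (by simp), hv.initial, hf]
  have hbound := norm_le_of_solvesAt hρ0 hρ.lipG hρ.lipH hφ hxc h0 hsolve
  refine ⟨x, fun t => hx t, hxc, hbound, fun t ht => hsolve t ht fun t' ht' => ?_⟩
  have := hbound t' ⟨ht'.1, ht'.2.trans ht.2⟩
  linarith

theorem exists_isSolution (hρ : IsGoodRadius hC ρ) {f : L2Torus} {φ : SeqSpace p}
    (hf : seq s φ = coeff f) (hφ : ‖φ‖ ≤ ρ / 2) : ∃ v, IsSolution s p 1 f v := by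
  have hρ0 := hρ.conv.pos
  have hφ' : ‖φ‖ ≤ ρ := by linarith
  obtain ⟨x, hxc, hxρ, hsolve⟩ := exists_solvesAt hρ0 hρ.lipG hρ.lipH hφ
  choose v hv using fun t => exists_coeff_eq_seq hC (x t)
  have hR : ∀ m : ZNonzero, ∀ t, ∑' n : ℕ, termR (n + 2) t (coeff (v t)) m
      = seqCLM s m (interaction (normalH hC) t (x t)) := fun m t => by
    rw [hv, seqCLM_apply]
    exact (hasSum_termR hρ.conv (hxρ t) t m).tsum_eq
  -- The fixed point was not required to start at φ. At t = 0 the equation reads x(0) - φ = F(0,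
  -- x(0)) - F(0, φ), and the constant 1/8 forces equality.
  have hx0 : x 0 = φ := by
    have h := hsolve 0 (by simp)
    rw [SolvesAt, intervalIntegral.integral_same, add_zero] at h
    have h1 := hρ.lipG.lipschitz 0 (x 0) (by simpa using hxρ 0) φ (by simpa using hφ')
    have h2 : x 0 - φ = interaction (normalG hC) 0 (x 0) - interaction (normalG hC) 0 φ := by
      nth_rewrite 1 [h]; abel
    rw [← h2] at h1
    have h3 := norm_nonneg (x 0 - φ)
    exact sub_eq_zero.1 (norm_le_zero_iff.1 (by linarith))
  refine ⟨v, ⟨⟨fun t _ => ⟨?_, ?_⟩, fun t₀ _ => ?_⟩, ?_, fun t _ => ?_, ?_, fun m hm => ?_,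
    fun t ht m hm => ?_⟩⟩
  · rw [hv, seq_zero_freq]
  · rw [hv, flNorm_seq]; exact enorm_lt_top
  · have h := tendsto_iff_edist_tendsto_0.1 (hxc.tendsto t₀)
    refine (h.mono_left nhdsWithin_le_nhds).congr fun t => ?_
    rw [edist_eq_enorm_sub, enorm_sub_eq_flNorm (hv t).symm (hv t₀).symm]
  · refine coeff_injective ?_
    rw [hv, hx0, hf]
  · rw [hv]
    exact seriesConverge_seq hρ.conv (hxρ t) t
  · refine (lintegral_mono (g := fun _ => 2 * ENNReal.ofReal ρ) fun t => ?_).trans_lt ?_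
    · rw [hv]
      exact tsum_flNorm_termR_le hρ.conv (hxρ t) t
    · rw [lintegral_const]
      exact ENNReal.mul_lt_top (ENNReal.mul_lt_top (by simp) ENNReal.ofReal_lt_top) (by simp)
  · simp only [hR ⟨m, hm⟩]
    have h : ContinuousOn (fun t => interaction (normalH hC) t (x t)) univ :=
      hρ.lipH.comp_continuousOn hxc.continuousOn fun t _ => hxρ t
    exact ((seqCLM s ⟨m, hm⟩).continuous.comp (continuousOn_univ.1 h)).intervalIntegrable _ _
  · have h := (solvesAt_iff hρ hφ' ht.1 hxc.continuousOn fun t' _ => hxρ t').1 (hsolve t ht) m hm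
    simp only [hv, ← hf]
    exact h

theorem isSolution_unique (hρ : IsGoodRadius hC ρ) {f : L2Torus} {φ : SeqSpace p}
    (hf : seq s φ = coeff f) (hφ : ‖φ‖ ≤ ρ / 2) {v w : ℝ → L2Torus}
    (hv : IsSolution s p 1 f v) (hw : IsSolution s p 1 f w) : EqOn w v (Icc 0 1) := by
  have hρ0 := hρ.conv.pos
  obtain ⟨x, hx, hxc, hxb, hxs⟩ := exists_path_of_isSolution hρ hf hφ hv
  obtain ⟨y, hy, hyc, hyb, hys⟩ := exists_path_of_isSolution hρ hf hφ hw
  have h := eqOn_of_solvesAt hρ.lipG hρ.lipH hyc hxc (fun t ht => (hyb t ht).trans (by linarith))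
    (fun t ht => (hxb t ht).trans (by linarith)) hys hxs
  intro t ht
  refine coeff_injective ?_
  rw [← hx t ht, ← hy t ht, h ht]

/-- Solutions with small data in `FL₀^{s,p}` inherit higher regularity of the data. -/
theorem flNorm_le_of_isSolution (hρ : IsGoodRadius hC ρ) {σ ρ' : ℝ} (hσ : 0 ≤ σ)
    (hρ' : IsConvRadius hC σ ρ') (hle : ρ' ≤ ρ) {f : L2Torus} {φ : SeqSpace p}
    (hf : seq s φ = coeff f) (hφ : ‖φ‖ ≤ ρ' / 2) {v : ℝ → L2Torus} (hv : IsSolution s p 1 f v)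
    {t : ℝ} (ht : t ∈ Icc (0 : ℝ) 1) :
    flNorm (s + σ) p (coeff (v t)) ≤ ENNReal.ofReal (3 / 2) * flNorm (s + σ) p (coeff f) := by
  have hρ0 := hρ'.pos
  obtain ⟨x, hx, hxc, hxb, hxs⟩ := exists_path_of_isSolution hρ hf (by linarith) hv
  rw [← hx t ht, ← hf]
  refine flNorm_add_le_of_truncOp hσ fun N hN => ?_
  have h := norm_clm_le_of_solvesAt ((truncOp σ N hσ hN).restrictScalars ℝ)
    (right_mem_Icc.2 zero_le_one) (hρ.lipH.mono hle)
    (norm_truncOp_interaction_le hσ hN fun y hy => norm_truncOp_normalG_le hρ' hσ hN hy)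
    (norm_truncOp_interaction_le hσ hN fun y hy => norm_truncOp_normalH_le hρ' hσ hN hy)
    (by linarith) hxc (fun t ht => (hxb t ht).trans (by linarith)) hxs t ht
  refine le_trans ?_ (mul_le_mul' le_rfl (enorm_truncOp_le (s := s) hσ hN φ))
  rw [← ofReal_norm, ← ofReal_norm, ← ENNReal.ofReal_mul (by norm_num)]
  exact ENNReal.ofReal_le_ofReal h

theorem norm_le_of_flNorm_le {f : L2Torus} {φ : SeqSpace p} (hf : seq s φ = coeff f) {r : ℝ}
    (hr : 0 ≤ r) (h : flNorm s p (coeff f) ≤ ENNReal.ofReal r) : ‖φ‖ ≤ r := by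
  rw [← hf, flNorm_seq, ← ofReal_norm] at h
  exact (ENNReal.ofReal_le_ofReal_iff hr).1 h

end Solutions

theorem FL_add_subset {s p σ : ℝ} (hp : 0 ≤ p) (hσ : 0 ≤ σ) : FL (s + σ) p ⊆ FL s p := by
  rintro f ⟨h0, h⟩
  refine ⟨h0, lt_of_le_of_lt ?_ h⟩
  rw [flNorm_eq_ellNorm, flNorm_eq_ellNorm]
  refine ellNorm_mono hp fun k => ?_
  gcongr
  · exact one_le_abs_znonzero k
  · linarith

end NormalForm

end

open NormalForm in
theorem mainTheorem3 (s p : ℝ)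
    (hsp : (1 / 2 - 1 / p < s ∧ 2 < p) ∨ (0 ≤ s ∧ p = 2)) :
    ∃ δ₁ : ℝ, 0 < δ₁ ∧ ∃ T : ℝ → ℝ, (∀ r, 0 < T r) ∧
      -- existence and uniqueness
      (∀ φ ∈ FL s p, flNorm s p (coeff φ) ≤ ENNReal.ofReal δ₁ →
        ∃ v : ℝ → L2Torus,
          IsSolution s p (T (flNorm s p (coeff φ)).toReal) φ v ∧
          ∀ w : ℝ → L2Torus, IsSolution s p (T (flNorm s p (coeff φ)).toReal) φ w →
            Set.EqOn w v (Set.Icc 0 (T (flNorm s p (coeff φ)).toReal))) ∧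
      -- persistence of regularity
      (∀ σ : ℝ, 0 < σ →
        ∃ δ : ℝ, 0 < δ ∧ δ ≤ δ₁ ∧ ∃ T' : ℝ → ℝ, (∀ r, 0 < T' r ∧ T' r ≤ T r) ∧
          ∀ φ ∈ FL (s + σ) p, flNorm s p (coeff φ) ≤ ENNReal.ofReal δ →
            ∀ v : ℝ → L2Torus,
              IsSolution s p (T (flNorm s p (coeff φ)).toReal) φ v →
              ∀ t ∈ Set.Icc 0 (T' (flNorm s p (coeff φ)).toReal),
                v t ∈ FL (s + σ) p ∧
                flNorm (s + σ) p (coeff (v t)) ≤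
                  ENNReal.ofReal (5 / 2) * flNorm (s + σ) p (coeff φ)) := by
  have hp : 1 ≤ p := by
    rcases hsp with ⟨-, h⟩ | ⟨-, h⟩ <;> linarith
  have hfact : Fact (1 ≤ p) := ⟨hp⟩
  obtain ⟨C, hC⟩ := exists_flBounds hsp
  obtain ⟨ρ, hρ⟩ := exists_isGoodRadius hC
  have hρ0 := hρ.conv.pos
  -- The existence time is 1 for all admissible data, since the Lipschitz constants are already
  -- small.
  refine ⟨ρ / 2, by positivity, fun _ => 1, fun _ => one_pos, ?_, ?_⟩
  · intro f hf hfρ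
    obtain ⟨φ, hφ⟩ := exists_seq_eq (p := p) hf.1 hf.2
    have hn := norm_le_of_flNorm_le hφ (by positivity) hfρ
    obtain ⟨v, hv⟩ := exists_isSolution hρ hφ hn
    exact ⟨v, hv, fun w hw => isSolution_unique hρ hφ hn hv hw⟩
  · intro σ hσ
    obtain ⟨ρ₁, hρ₁⟩ := exists_isConvRadius hC hσ.le
    have h1 := hρ₁.pos
    -- Below ρ for the path and its bound in FL₀^{s,p}, below ρ₁ for the σ-weighted estimates.
    have hρ' := hρ₁.mono (ρ' := min ρ ρ₁) (by positivity) (min_le_right _ _)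
    have h0 := hρ'.pos
    refine ⟨min ρ ρ₁ / 2, by positivity, by gcongr; exact min_le_left _ _, fun _ => 1,
      fun _ => ⟨one_pos, le_rfl⟩, ?_⟩
    intro f hf hfρ v hv t ht
    have hfs := FL_add_subset (by linarith) hσ.le hf
    obtain ⟨φ, hφ⟩ := exists_seq_eq (p := p) hfs.1 hfs.2
    have hn := norm_le_of_flNorm_le hφ (by positivity) hfρ
    have h := (flNorm_le_of_isSolution hρ hσ.le hρ' (min_le_left _ _) hφ hn hv ht).trans
      (mul_le_mul' (ENNReal.ofReal_le_ofReal (show (3 / 2 : ℝ) ≤ 5 / 2 by norm_num)) le_rfl)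
    exact ⟨⟨(hv.continuous.1 t ht).1,
      h.trans_lt (ENNReal.mul_lt_top ENNReal.ofReal_lt_top hf.2)⟩, h⟩
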